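/- Let $q$ be a prime power and let $V$ be an $n$-dimensional vector space over the finite field $\mathbb F_q$. A poset $P$ is a subposet of a poset $Q$ if there is an injection $\phi:P\to Q$ such that $x\le_P y$ implies $\phi(x)\le_Q\phi(y)$, and it is an induced subposet if moreover $\phi(x)\le_Q\phi(y)$ implies $x\le_P y$. For a collection $\mathcal P$ of finite posets, let $\mathrm{La}_q(n,\mathcal P)$ (respectively $\mathrm{La}^*_q(n,\mathcal P)$) be the maximum size of a family of subspaces of $V$, ordered by inclusion, which contains no $P\in\mathcal P$ as a subposet (respectively as an induced subposet). Let $Y_k$ be the poset with elements $x_1,\dots,x_k,y,z$ and $x_1\le x_2\le\dots\le x_k\le y,z$ (with $y$ and $z$ incomparable), and let $Y'_k$ be the same poset with all relations reversed. Let $\Sigma_q(n,k)$ be the sum of the $k$ largest of the $n+1$ Gaussian binomial coefficients $\binom{n}{i}_q=\prod_{0\le j<i}\frac{q^{n-j}-1}{q^{i-j}-1}$, $0\le i\le n$, counted with multiplicity. **Theorem.** Let $k\ge 1$ and $n\ge k+1$. Then $$\mathrm{La}^*_q(n,\{Y_k,Y'_k\})=\Sigma_q(n,k),$$ and also, as conjectured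 by Shahriari and Yu, $$\mathrm{La}_q(n,\{Y_k,Y'_k\})=\Sigma_q(n,k).$$ -/

import Mathlib

/-- The poset `Y_k`: elements `x_1, …, x_k, y, z` with `x_1 ≤ ⋯ ≤ x_k ≤ y, z`
(the elements `y` and `z` are incomparable). -/
inductive YPoset (k : ℕ) : Type
  | x (i : Fin k) : YPoset k
  | y : YPoset k
  | z : YPoset k

namespace YPoset

/-- The order relation of `Y_k`. -/
def le {k : ℕ} : YPoset k → YPoset k → Prop
  | x i, x j => i ≤ j
  | x _, y => True
  | x _, z => True
  | y, y => True
  | z, z => True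
  | _, _ => False

instance (k : ℕ) : PartialOrder (YPoset k) where
  le := le
  le_refl a := by cases a <;> simp [le]
  le_trans a b c hab hbc := by
    cases a <;> cases b <;> cases c <;> simp only [le] at hab hbc ⊢
    exact le_trans hab hbc
  le_antisymm a b hab hba := by
    cases a <;> cases b <;> simp only [le] at hab hba ⊢
    exact congrArg x (le_antisymm hab hba)

instance (k : ℕ) : Finite (YPoset k) := by
  refine Finite.of_surjective
    (fun s : Fin k ⊕ Bool => Sum.elim x (fun b => if b then y else z) s) ?_
  rintro (i | _ | _)
  · exact ⟨Sum.inl i, rfl⟩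
  · exact ⟨Sum.inr true, rfl⟩
  · exact ⟨Sum.inr false, rfl⟩

noncomputable instance (k : ℕ) : Fintype (YPoset k) := Fintype.ofFinite _

end YPoset

/-- The pair `{Y_k, Y'_k}`, where `Y'_k` is `Y_k` with all relations reversed. -/
noncomputable def yPair (k : ℕ) : Set FinPartOrd.{0} :=
  {FinPartOrd.of (YPoset k), FinPartOrd.of (YPoset k)ᵒᵈ}

/-- `P` is a subposet of `Q`: there is an injection `φ` such that `x ≤ y` implies `φ x ≤ φ y`. -/
def IsSubposet (P Q : Type*) [PartialOrder P] [PartialOrder Q] : Prop :=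
  ∃ φ : P → Q, Function.Injective φ ∧ ∀ a b, a ≤ b → φ a ≤ φ b

/-- `P` is an induced subposet of `Q`: there is an injection `φ` such that `x ≤ y` if and only if
`φ x ≤ φ y`. -/
def IsInducedSubposet (P Q : Type*) [PartialOrder P] [PartialOrder Q] : Prop :=
  ∃ φ : P → Q, Function.Injective φ ∧ ∀ a b, a ≤ b ↔ φ a ≤ φ b

/-- The sizes of the finite families in the poset `α` containing no `P ∈ Ps` as a subposet. -/
def freeSizes (α : Type*) [PartialOrder α] (Ps : Set FinPartOrd.{0}) : Set ℕ :=
  {m | ∃ F : Finset α, F.card = m ∧ ∀ P ∈ Ps, ¬ IsSubposet P F}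

/-- The sizes of the finite families in the poset `α` containing no `P ∈ Ps` as an induced
subposet. -/
def inducedFreeSizes (α : Type*) [PartialOrder α] (Ps : Set FinPartOrd.{0}) : Set ℕ :=
  {m | ∃ F : Finset α, F.card = m ∧ ∀ P ∈ Ps, ¬ IsInducedSubposet P F}

/-- `La_q(n, Ps)`: the maximum size of a family of subspaces of the vector space `V` which does not
contain any `P ∈ Ps` as a subposet. -/
noncomputable def La (K V : Type*) [Field K] [AddCommGroup V] [Module K V]
    (Ps : Set FinPartOrd.{0}) : ℕ :=
  sSup (freeSizes (Submodule K V) Ps)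

/-- `La*_q(n, Ps)`: the maximum size of a family of subspaces of the vector space `V` which does not
contain any `P ∈ Ps` as an induced subposet. -/
noncomputable def LaStar (K V : Type*) [Field K] [AddCommGroup V] [Module K V]
    (Ps : Set FinPartOrd.{0}) : ℕ :=
  sSup (inducedFreeSizes (Submodule K V) Ps)

/-- Over a finite field the supremum defining `La` is an attained maximum. -/
theorem isGreatest_La (K V : Type*) [Field K] [Finite K] [AddCommGroup V] [Module K V]
    [FiniteDimensional K V] (Ps : Set FinPartOrd.{0}) (hPs : ∀ P ∈ Ps, Nonempty P) :
    IsGreatest (freeSizes (Submodule K V) Ps) (La K V Ps) := by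
  have : Finite V := Module.finite_of_finite K
  letI : Fintype (Submodule K V) := Fintype.ofFinite _
  have hb : BddAbove (freeSizes (Submodule K V) Ps) := by
    refine ⟨Fintype.card (Submodule K V), ?_⟩
    rintro m ⟨F, rfl, -⟩
    exact F.card_le_univ
  refine ⟨Nat.sSup_mem ⟨0, ∅, rfl, ?_⟩ hb, fun m hm => le_csSup hb hm⟩
  rintro P hP ⟨φ, -⟩
  obtain ⟨p⟩ := hPs P hP
  exact absurd (φ p).2 (Finset.notMem_empty _)

/-- Over a finite field the supremum defining `LaStar` is an attained maximum. -/
theorem isGreatest_LaStar (K V : Type*) [Field K] [Finite K] [AddCommGroup V] [Module K V]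
    [FiniteDimensional K V] (Ps : Set FinPartOrd.{0}) (hPs : ∀ P ∈ Ps, Nonempty P) :
    IsGreatest (inducedFreeSizes (Submodule K V) Ps) (LaStar K V Ps) := by
  have : Finite V := Module.finite_of_finite K
  letI : Fintype (Submodule K V) := Fintype.ofFinite _
  have hb : BddAbove (inducedFreeSizes (Submodule K V) Ps) := by
    refine ⟨Fintype.card (Submodule K V), ?_⟩
    rintro m ⟨F, rfl, -⟩
    exact F.card_le_univ
  refine ⟨Nat.sSup_mem ⟨0, ∅, rfl, ?_⟩ hb, fun m hm => le_csSup hb hm⟩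
  rintro P hP ⟨φ, -⟩
  obtain ⟨p⟩ := hPs P hP
  exact absurd (φ p).2 (Finset.notMem_empty _)

/-- The `q`-binomial coefficient `∏_{0 ≤ i < k} (q^(n-i) - 1) / (q^(k-i) - 1)`. -/
def qBinom (q n k : ℕ) : ℚ :=
  ∏ i ∈ Finset.range k, ((q : ℚ) ^ (n - i) - 1) / ((q : ℚ) ^ (k - i) - 1)

/-- `Σ_q(n, k)`: the sum of the `k` largest among the `q`-binomial coefficients
`qBinom q n i`, `0 ≤ i ≤ n` (counted with multiplicity). -/
def qSigma (q n k : ℕ) : ℚ :=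
  ((((Multiset.range (n + 1)).map (qBinom q n)).sort (· ≥ ·)).take k).sum

/-! The lower bound takes the `k` largest levels: a chain there has at most `k` members, while `Y_k`
and its reverse contain chains of `k + 1`.

For the upper bound only two consequences of freeness are used, `UpFree` and `DownFree`. Averaging
over all images `g E` of a fixed flag, the mean number of members of `F` on a flag is the Lubell
function, the sum of the proportions of the levels occupied by `F`. If it is at most `k`, then `#F`
is at most the sum of the `k` largest levels (`card_le_sum_add_mul_lubell`).

For `k ≥ 2` and `⊥, ⊤ ∉ F`, a flag with more than `k` members has a window of `k - 1` consecutive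
members, the first not minimal and the last not maximal in `F`. Adding a member of `F` below the
window gives a `k`-chain, so the members above it are pairwise comparable, at most one per level.
Rerandomizing the flag above the window spreads such a member over many subspaces, so the flag meets
on average at most `1/2` of them. The same holds below, for a total of `(k - 1) + 1/2 + 1/2`. If `⊥
∈ F`, deleting `⊥` and `⊤` leaves an `UpFree (k - 1)` family with Lubell function at most `k - 1/2`,
and the slack pays for the two deleted members; `⊤ ∈ F` is dual.

For `k = 1` there is no window. If `⊥ ∈ F`, then `F` is a chain. Otherwise the levels above the
middle are pushed down one by one without losing members (`exists_push_step`), then the same is done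
in the dual space. What remains is one middle level, or two when `n` is odd; these are handled by
averaging over intervals of length 3, which are projective planes (`plane_bound`). -/

open Module Finset

set_option linter.unusedSectionVars false

/-! ### Transitivity properties of the general linear group on subspaces. -/

section Subspaces

open scoped Classical

variable {K V : Type*} [Field K] [AddCommGroup V] [Module K V] [FiniteDimensional K V]

/-- Between two nested subspaces there are subspaces of every intermediate dimension. -/
lemma exists_finrank_eq_between {u v : Submodule K V} (huv : u ≤ v) {l : ℕ}
    (hl : finrank K u ≤ l) (hl' : l ≤ finrank K v) :
    ∃ w : Submodule K V, u ≤ w ∧ w ≤ v ∧ finrank K w = l := by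
  induction l, hl using Nat.le_induction with
  | base => exact ⟨u, le_rfl, huv, rfl⟩
  | succ l hl ih =>
    obtain ⟨w, huw, hwv, hw⟩ := ih (by omega)
    have hlt : w < v := lt_of_le_of_ne hwv (by rintro rfl; omega)
    obtain ⟨t, htv, htw⟩ := SetLike.exists_of_lt hlt
    refine ⟨w ⊔ K ∙ t, huw.trans le_sup_left, sup_le hwv ?_, ?_⟩
    · simpa [Submodule.span_singleton_le_iff_mem] using htv
    · rw [Submodule.finrank_sup_span_singleton htw, hw]

/-- A complete flag, indexed by dimension. -/
lemma exists_flag {n : ℕ} (hV : finrank K V = n) :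
    ∃ E : ℕ → Submodule K V, Monotone E ∧ ∀ i ≤ n, finrank K (E i) = i := by
  let b := finBasisOfFinrankEq K V hV
  have hrank : ∀ k : Fin (n + 1), finrank K (b.flag k) = k := by
    intro k
    induction k using Fin.induction with
    | zero => simp
    | succ k ih =>
      rw [b.flag_succ, sup_comm, Submodule.finrank_sup_span_singleton, ih]
      · simp
      · simp
  refine ⟨fun i => b.flag ⟨min i n, by omega⟩, fun i j hij => b.flag_mono ?_, fun i hi => ?_⟩
  · exact Fin.mk_le_mk.2 (by omega)
  · rw [hrank]
    exact min_eq_left hi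

/-- Automorphisms of complementary summands glue. -/
lemma exists_equiv_of_isCompl {A A' B B' : Submodule K V} (hA : IsCompl A A') (hB : IsCompl B B')
    (e : A ≃ₗ[K] B) (e' : A' ≃ₗ[K] B') :
    ∃ h : V ≃ₗ[K] V, (∀ a : A, h a = e a) ∧ ∀ a : A', h a = e' a := by
  refine ⟨(Submodule.prodEquivOfIsCompl A A' hA).symm ≪≫ₗ (e.prodCongr e') ≪≫ₗ
    Submodule.prodEquivOfIsCompl B B' hB, fun a => ?_, fun a => ?_⟩
  · simp
  · simp

lemma map_eq_of_le_of_finrank_eq {A B : Submodule K V} (hAB : finrank K A = finrank K B)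
    (h : V ≃ₗ[K] V) (hle : ∀ a ∈ A, h a ∈ B) : A.map (h : V →ₗ[K] V) = B := by
  apply Submodule.eq_of_le_of_finrank_eq
  · rintro _ ⟨a, ha, rfl⟩
    exact hle a ha
  · rw [← hAB]
    exact LinearEquiv.finrank_map_eq h A

lemma exists_equiv_map_eq {A B : Submodule K V} (hAB : finrank K A = finrank K B) :
    ∃ h : V ≃ₗ[K] V, A.map (h : V →ₗ[K] V) = B := by
  obtain ⟨A', hA⟩ := A.exists_isCompl
  obtain ⟨B', hB⟩ := B.exists_isCompl
  have h1 := Submodule.finrank_add_eq_of_isCompl hA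
  have h2 := Submodule.finrank_add_eq_of_isCompl hB
  obtain ⟨h, hh, -⟩ := exists_equiv_of_isCompl hA hB (LinearEquiv.ofFinrankEq _ _ hAB)
    (LinearEquiv.ofFinrankEq A' B' (by omega))
  refine ⟨h, map_eq_of_le_of_finrank_eq hAB h fun a ha => ?_⟩
  rw [hh ⟨a, ha⟩]
  exact Subtype.coe_prop _

/-- The pointwise stabilizer of `u` is transitive on the subspaces above `u` of given dimension. -/
lemma exists_equiv_map_eq_of_ge {u A B : Submodule K V} (hA : u ≤ A) (hB : u ≤ B)
    (hAB : finrank K A = finrank K B) :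
    ∃ h : V ≃ₗ[K] V, (∀ w ∈ u, h w = w) ∧ A.map (h : V →ₗ[K] V) = B := by
  obtain ⟨Q, hQ⟩ := u.exists_isCompl
  -- By the modular law `A` splits as `u ⊕ (Q ⊓ A)`, so it suffices to glue the identity of `u` to
  -- an automorphism of `Q`.
  have key : ∀ A : Submodule K V, u ≤ A → u ⊔ Q ⊓ A = A ∧
      finrank K u + finrank K (A.comap Q.subtype) = finrank K A := by
    intro A hA
    have h1 : u ⊔ Q ⊓ A = A := by
      rw [← sup_inf_assoc_of_le Q hA, hQ.sup_eq_top, top_inf_eq]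
    have h2 := Submodule.finrank_sup_add_finrank_inf_eq u (Q ⊓ A)
    have h3 : u ⊓ (Q ⊓ A) = ⊥ := by
      rw [eq_bot_iff, ← hQ.inf_eq_bot]
      exact inf_le_inf_left _ inf_le_left
    rw [h1, h3, finrank_bot, add_zero] at h2
    refine ⟨h1, ?_⟩
    rw [h2, ← Submodule.finrank_map_subtype_eq, Submodule.map_comap_subtype]
  obtain ⟨hA1, hA2⟩ := key A hA
  obtain ⟨hB1, hB2⟩ := key B hB
  obtain ⟨φ, hφ⟩ := exists_equiv_map_eq (K := K) (V := Q)
    (A := A.comap Q.subtype) (B := B.comap Q.subtype) (by omega)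
  obtain ⟨h, hu, hq⟩ := exists_equiv_of_isCompl hQ hQ (LinearEquiv.refl K u) φ
  have hu' : ∀ w ∈ u, h w = w := fun w hw => by simpa using hu ⟨w, hw⟩
  refine ⟨h, hu', map_eq_of_le_of_finrank_eq hAB h fun a ha => ?_⟩
  rw [← hA1] at ha
  obtain ⟨x, hx, y, hy, rfl⟩ := Submodule.mem_sup.1 ha
  rw [map_add]
  refine B.add_mem ?_ ?_
  · rw [hu' x hx]
    exact hB hx
  · rw [hq ⟨y, hy.1⟩]
    have : φ ⟨y, hy.1⟩ ∈ (A.comap Q.subtype).map (φ : Q →ₗ[K] Q) := ⟨⟨y, hy.1⟩, hy.2, rfl⟩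
    rw [hφ] at this
    exact this

/-- The pointwise stabilizer of `V ⧸ v` is transitive on the subspaces of `v` of given dimension. -/
lemma exists_equiv_map_eq_of_le {v A B : Submodule K V} (hA : A ≤ v) (hB : B ≤ v)
    (hAB : finrank K A = finrank K B) :
    ∃ h : V ≃ₗ[K] V, (∀ w, h w - w ∈ v) ∧ A.map (h : V →ₗ[K] V) = B := by
  obtain ⟨Q, hQ⟩ := v.exists_isCompl
  obtain ⟨φ, hφ⟩ := exists_equiv_map_eq (K := K) (V := v)
    (A := A.comap v.subtype) (B := B.comap v.subtype) (by
      rw [(Submodule.comapSubtypeEquivOfLe hA).finrank_eq,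
        (Submodule.comapSubtypeEquivOfLe hB).finrank_eq, hAB])
  obtain ⟨h, hv, hq⟩ := exists_equiv_of_isCompl hQ hQ φ (LinearEquiv.refl K Q)
  refine ⟨h, fun w => ?_, map_eq_of_le_of_finrank_eq hAB h fun a ha => ?_⟩
  · obtain ⟨x, hx, y, hy, rfl⟩ := Submodule.mem_sup.1
      (show w ∈ v ⊔ Q by rw [hQ.sup_eq_top]; trivial)
    rw [map_add, hv ⟨x, hx⟩, hq ⟨y, hy⟩]
    simpa using v.sub_mem (φ ⟨x, hx⟩).2 hx
  · rw [hv ⟨a, hA ha⟩]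
    have : φ ⟨a, hA ha⟩ ∈ (A.comap v.subtype).map (φ : v →ₗ[K] v) := ⟨⟨a, hA ha⟩, ha, rfl⟩
    rw [hφ] at this
    exact this

lemma map_eq_of_fix {u w : Submodule K V} (hwu : w ≤ u) {h : V ≃ₗ[K] V}
    (hh : ∀ x ∈ u, h x = x) : w.map (h : V →ₗ[K] V) = w :=
  map_eq_of_le_of_finrank_eq rfl h fun a ha => by rwa [hh a (hwu ha)]

lemma map_eq_of_sub_mem {v w : Submodule K V} (hvw : v ≤ w) {h : V ≃ₗ[K] V}
    (hh : ∀ x, h x - x ∈ v) : w.map (h : V →ₗ[K] V) = w :=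
  map_eq_of_le_of_finrank_eq rfl h fun a ha => by
    simpa using w.add_mem (hvw (hh a)) ha

lemma map_equiv_injective (g : V ≃ₗ[K] V) :
    Function.Injective fun A : Submodule K V => A.map (g : V →ₗ[K] V) :=
  Submodule.map_injective_of_injective g.injective

lemma map_mul_equiv (g h : V ≃ₗ[K] V) (A : Submodule K V) :
    A.map ((g * h : V ≃ₗ[K] V) : V →ₗ[K] V) =
      (A.map (h : V →ₗ[K] V)).map (g : V →ₗ[K] V) := by
  rw [← Submodule.map_comp]
  rfl

/-- Used to turn comparability into "at most one member on each level". -/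
lemma eq_of_comparable_of_finrank_eq {x y : Submodule K V} (h : x ≤ y ∨ y ≤ x)
    (hxy : finrank K x = finrank K y) : x = y := by
  rcases h with h | h
  · exact Submodule.eq_of_le_of_finrank_eq h hxy
  · exact (Submodule.eq_of_le_of_finrank_eq h hxy.symm).symm

end Subspaces

/-! ### Counting subspaces in intervals; Gaussian binomials. -/

section Counting

open scoped Classical

/-- The `q`-integer `1 + q + ⋯ + q^(m-1)`. -/
def qInt (q m : ℕ) : ℕ := ∑ i ∈ range m, q ^ i

lemma qInt_mul_pred {q : ℕ} (hq : 1 ≤ q) (m : ℕ) : qInt q m * (q - 1) + 1 = q ^ m := by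
  obtain ⟨r, rfl⟩ : ∃ r, q = r + 1 := ⟨q - 1, by omega⟩
  unfold qInt
  induction m with
  | zero => simp
  | succ m ih =>
    rw [sum_range_succ, pow_succ, add_mul, add_right_comm, ih]
    simp
    ring

lemma qInt_succ (q m : ℕ) : qInt q (m + 1) = qInt q m + q ^ m := sum_range_succ _ _

lemma qInt_lt_pow {q : ℕ} (hq : 2 ≤ q) (m : ℕ) : qInt q m < q ^ m := by
  have h := qInt_mul_pred (show 1 ≤ q by omega) m
  have : qInt q m * 1 ≤ qInt q m * (q - 1) := Nat.mul_le_mul_left _ (by omega)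
  omega

lemma qInt_mono (q : ℕ) : Monotone (qInt q) := fun _ _ h =>
  sum_le_sum_of_subset (range_mono h)

lemma two_pow_le_qInt {q : ℕ} (hq : 2 ≤ q) (m : ℕ) : 2 ^ m ≤ qInt q m + 1 := by
  induction m with
  | zero => simp
  | succ m ih =>
    rw [qInt_succ, pow_succ]
    have : 2 ^ m ≤ q ^ m := Nat.pow_le_pow_left hq m
    omega

variable {K V : Type*} [Field K] [AddCommGroup V] [Module K V] [FiniteDimensional K V]
  [Fintype K] [Fintype (Submodule K V)] {q : ℕ}

lemma card_filter_mem [Fintype V] (hq : Fintype.card K = q) (u : Submodule K V) :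
    #{t : V | t ∈ u} = q ^ finrank K u := by
  rw [← hq, ← Module.card_eq_pow_finrank (K := K) (V := u), Fintype.card_subtype]

lemma card_filter_mem_notMem [Fintype V] (hq : Fintype.card K = q) {u v : Submodule K V}
    (huv : u ≤ v) : #{t : V | t ∈ v ∧ t ∉ u} + q ^ finrank K u = q ^ finrank K v := by
  rw [← card_filter_mem hq u, ← card_filter_mem hq v, ← card_union_of_disjoint]
  · congr 1
    ext t
    simp only [mem_union, mem_filter, mem_univ, true_and]
    have := @huv t
    tauto
  · rw [disjoint_left]
    simp only [mem_filter, mem_univ, true_and]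
    tauto

/-- The number of subspaces of an interval which cover its bottom. -/
lemma card_covers_bot (hq : Fintype.card K = q) {u v : Submodule K V} (huv : u ≤ v) {d : ℕ}
    (hd : finrank K u + d = finrank K v) :
    #{w : Submodule K V | u ≤ w ∧ w ≤ v ∧ finrank K w = finrank K u + 1} = qInt q d := by
  have : Finite V := Module.finite_of_finite K
  have : Fintype V := Fintype.ofFinite V
  have hq2 : 2 ≤ q := hq ▸ Fintype.one_lt_card
  set W : Finset (Submodule K V) := {w | u ≤ w ∧ w ≤ v ∧ finrank K w = finrank K u + 1} with hW
  have hmaps : ∀ t ∈ ({t : V | t ∈ v ∧ t ∉ u} : Finset V), u ⊔ K ∙ t ∈ W := by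
    intro t ht
    simp only [mem_filter, mem_univ, true_and] at ht
    simp only [hW, mem_filter, mem_univ, true_and]
    exact ⟨le_sup_left, sup_le huv (by simpa [Submodule.span_singleton_le_iff_mem] using ht.1),
      Submodule.finrank_sup_span_singleton ht.2⟩
  have hcard := card_eq_sum_card_fiberwise hmaps
  -- A cover `w` of `u` is spanned over `u` by any vector of `w` outside `u`, and there are `q ^ (r
  -- + 1) - q ^ r` of these, where `r = dim u`.
  have hfib : ∀ w ∈ W, #{t ∈ ({t : V | t ∈ v ∧ t ∉ u} : Finset V) | u ⊔ K ∙ t = w} =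
      q ^ finrank K u * (q - 1) := by
    intro w hw
    simp only [hW, mem_filter, mem_univ, true_and] at hw
    have h1 := card_filter_mem_notMem hq hw.1
    rw [hw.2.2, pow_succ] at h1
    have h2 : q ^ finrank K u * (q - 1) + q ^ finrank K u = q ^ finrank K u * q := by
      obtain ⟨r, rfl⟩ : ∃ r, q = r + 1 := ⟨q - 1, by omega⟩
      simp
      ring
    have h3 : ({t ∈ ({t : V | t ∈ v ∧ t ∉ u} : Finset V) | u ⊔ K ∙ t = w} : Finset V) =
        ({t : V | t ∈ w ∧ t ∉ u} : Finset V) := by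
      ext t
      simp only [mem_filter, mem_univ, true_and]
      constructor
      · rintro ⟨⟨-, htu⟩, rfl⟩
        exact ⟨Submodule.mem_sup_right (Submodule.mem_span_singleton_self t), htu⟩
      · rintro ⟨htw, htu⟩
        refine ⟨⟨hw.2.1 htw, htu⟩, Submodule.eq_of_le_of_finrank_le (sup_le hw.1 ?_) ?_⟩
        · simpa [Submodule.span_singleton_le_iff_mem] using htw
        · rw [Submodule.finrank_sup_span_singleton htu, hw.2.2]
    rw [h3]
    omega
  rw [sum_congr rfl hfib, sum_const, smul_eq_mul] at hcard
  have h1 := card_filter_mem_notMem hq huv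
  have h2 := qInt_mul_pred (show 1 ≤ q by omega) d
  rw [hcard, ← hd, pow_add, ← h2] at h1
  have hpos : 0 < q ^ finrank K u * (q - 1) := by
    apply Nat.mul_pos (by positivity) (by omega)
  apply Nat.eq_of_mul_eq_mul_right hpos
  nlinarith

lemma finrank_dualAnnihilator (W : Submodule K V) :
    finrank K W + finrank K W.dualAnnihilator = finrank K V :=
  Subspace.finrank_add_finrank_dualAnnihilator_eq W

/-- The number of subspaces of an interval which are covered by its top. -/
lemma card_covers_top (hq : Fintype.card K = q) {u v : Submodule K V} (huv : u ≤ v) {d : ℕ}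
    (hd : finrank K u + d = finrank K v) :
    #{w : Submodule K V | u ≤ w ∧ w ≤ v ∧ finrank K w + 1 = finrank K v} = qInt q d := by
  have : Finite V := Module.finite_of_finite K
  have : Finite (Dual K V) := Module.finite_of_finite K
  have : Fintype (Submodule K (Dual K V)) := Fintype.ofFinite _
  have hu := finrank_dualAnnihilator u
  have hv := finrank_dualAnnihilator v
  rw [← card_covers_bot hq (V := Dual K V) (u := v.dualAnnihilator) (v := u.dualAnnihilator)
    (Subspace.dualAnnihilator_le_dualAnnihilator_iff.2 huv) (d := d) (by omega)]
  refine card_bij (fun w _ => w.dualAnnihilator) ?_ ?_ ?_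
  · intro w hw
    have h1 := finrank_dualAnnihilator w
    simp only [mem_filter, mem_univ, true_and] at hw ⊢
    exact ⟨Subspace.dualAnnihilator_le_dualAnnihilator_iff.2 hw.2.1,
      Subspace.dualAnnihilator_le_dualAnnihilator_iff.2 hw.1, by omega⟩
  · intro w _ w' _ h
    exact Subspace.dualAnnihilator_inj.1 h
  · intro w hw
    obtain ⟨w', rfl⟩ : ∃ w' : Submodule K V, w'.dualAnnihilator = w :=
      ⟨w.dualCoannihilator, Subspace.dualCoannihilator_dualAnnihilator_eq⟩
    have h1 := finrank_dualAnnihilator w'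
    simp only [mem_filter, mem_univ, true_and] at hw
    rw [Subspace.dualAnnihilator_le_dualAnnihilator_iff,
      Subspace.dualAnnihilator_le_dualAnnihilator_iff] at hw
    refine ⟨w', ?_, rfl⟩
    simp only [mem_filter, mem_univ, true_and]
    exact ⟨hw.2.1, hw.1, by omega⟩

/-- The intermediate levels of an interval of length `d` have at least `2 (d - 1)` elements. -/
lemma two_mul_le_card_level (hq : Fintype.card K = q) {u v : Submodule K V} (huv : u ≤ v) {l : ℕ}
    (hul : finrank K u < l) (hlv : l < finrank K v) :
    2 * (finrank K v - finrank K u - 1) ≤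
      #{w : Submodule K V | u ≤ w ∧ w ≤ v ∧ finrank K w = l} := by
  have hq2 : 2 ≤ q := hq ▸ Fintype.one_lt_card
  have haux : ∀ t : ℕ, 2 ≤ t → 4 * (t - 1) ≤ qInt q t + 1 := by
    intro t ht
    refine le_trans ?_ (two_pow_le_qInt hq2 t)
    induction t, ht using Nat.le_induction with
    | base => norm_num
    | succ t ht ih =>
      rw [pow_succ]
      omega
  -- Level `l` is at least half the length away from one end. Hyperplanes over that end in a
  -- subspace of dimension `l + 1`, or dually covers of one of dimension `l - 1`, are then numerous
  -- enough, by `4 (t - 1) ≤ 2 ^ t`.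
  rcases le_total (finrank K v - l) (l - finrank K u) with h | h
  · obtain ⟨w, huw, hwv, hw⟩ := exists_finrank_eq_between huv (l := l + 1) (by omega) (by omega)
    have h1 := card_covers_top hq huw (d := l + 1 - finrank K u) (by omega)
    have h2 := haux (l + 1 - finrank K u) (by omega)
    calc 2 * (finrank K v - finrank K u - 1) ≤ qInt q (l + 1 - finrank K u) := by omega
      _ ≤ _ := by
        rw [← h1]
        refine card_le_card fun x hx => ?_
        simp only [mem_filter, mem_univ, true_and] at hx ⊢
        exact ⟨hx.1, hx.2.1.trans hwv, by omega⟩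
  · obtain ⟨w, huw, hwv, hw⟩ := exists_finrank_eq_between huv (l := l - 1) (by omega) (by omega)
    have h1 := card_covers_bot hq hwv (d := finrank K v - (l - 1)) (by omega)
    have h2 := haux (finrank K v - (l - 1)) (by omega)
    calc 2 * (finrank K v - finrank K u - 1) ≤ qInt q (finrank K v - (l - 1)) := by omega
      _ ≤ _ := by
        rw [← h1]
        refine card_le_card fun x hx => ?_
        simp only [mem_filter, mem_univ, true_and] at hx ⊢
        exact ⟨huw.trans hx.1, hx.2.1, by omega⟩

variable (K V) in
/-- The number of subspaces of dimension `i`. -/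
noncomputable def levelCard (i : ℕ) : ℕ := #{w : Submodule K V | finrank K w = i}

lemma levelCard_pos {n : ℕ} (hV : finrank K V = n) {i : ℕ} (hi : i ≤ n) : 0 < levelCard K V i := by
  obtain ⟨w, -, -, hw⟩ := exists_finrank_eq_between (K := K) (V := V) (u := ⊥) (v := ⊤) bot_le
    (l := i) (by simp) (by simpa [hV] using hi)
  exact card_pos.2 ⟨w, by simp [hw]⟩

/-- Double counting of the nested pairs in two adjacent levels. `qBinom_succ` is the same recursion
for the product formula. -/
lemma levelCard_mul (hq : Fintype.card K = q) {n : ℕ} (hV : finrank K V = n) {i : ℕ} (hi : i < n) :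
    levelCard K V i * qInt q (n - i) = levelCard K V (i + 1) * qInt q (i + 1) := by
  refine card_mul_eq_card_mul (fun x y : Submodule K V => x ≤ y) ?_ ?_
  · intro x hx
    simp only [mem_filter, mem_univ, true_and] at hx
    rw [← card_covers_bot hq (u := x) (v := ⊤) le_top (d := n - i)
      (by rw [finrank_top]; omega)]
    congr 1
    ext w
    simp [bipartiteAbove, hx, and_comm]
  · intro y hy
    simp only [mem_filter, mem_univ, true_and] at hy
    rw [← card_covers_top hq (u := ⊥) (v := y) bot_le (d := i + 1) (by simp [hy])]
    congr 1
    ext w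
    simp [bipartiteBelow, hy, and_comm]

lemma cast_qInt {q : ℕ} (hq : 2 ≤ q) (m : ℕ) : (qInt q m : ℚ) = ((q : ℚ) ^ m - 1) / (q - 1) := by
  have h : (2 : ℚ) ≤ q := by exact_mod_cast hq
  rw [qInt, Nat.cast_sum, ← geom_sum_eq (by linarith)]
  simp

lemma qBinom_succ {q : ℕ} (hq : 2 ≤ q) {n i : ℕ} (hi : i < n) :
    qBinom q n i * qInt q (n - i) = qBinom q n (i + 1) * qInt q (i + 1) := by
  have h : (2 : ℚ) ≤ q := by exact_mod_cast hq
  have hne : ∀ m : ℕ, 0 < m → (q : ℚ) ^ m - 1 ≠ 0 := fun m hm =>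
    sub_ne_zero.2 (one_lt_pow₀ (by linarith) hm.ne').ne'
  have hform : ∀ k, qBinom q n k = (∏ i ∈ range k, ((q : ℚ) ^ (n - i) - 1)) /
      ∏ i ∈ range k, ((q : ℚ) ^ (i + 1) - 1) := by
    intro k
    rw [qBinom, prod_div_distrib, ← prod_range_reflect (fun i => (q : ℚ) ^ (i + 1) - 1)]
    congr 1
    refine prod_congr rfl fun j hj => ?_
    rw [mem_range] at hj
    congr 2
    omega
  rw [hform, hform, prod_range_succ, prod_range_succ, cast_qInt hq, cast_qInt hq]
  have h1 := hne (n - i) (by omega)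
  have h2 := hne (i + 1) (by omega)
  have h3 : ∏ i ∈ range i, ((q : ℚ) ^ (i + 1) - 1) ≠ 0 :=
    prod_ne_zero_iff.2 fun j _ => hne _ (by omega)
  have h4 : (q : ℚ) - 1 ≠ 0 := by linarith
  field_simp

/-- The Gaussian binomial coefficient counts the subspaces of given dimension. -/
lemma levelCard_eq_qBinom (hq : Fintype.card K = q) {n : ℕ} (hV : finrank K V = n) {i : ℕ}
    (hi : i ≤ n) : (levelCard K V i : ℚ) = qBinom q n i := by
  have hq2 : 2 ≤ q := hq ▸ Fintype.one_lt_card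
  induction i with
  | zero => simp [levelCard, qBinom, filter_eq']
  | succ i ih =>
    have h1 := levelCard_mul (V := V) hq hV (i := i) (by omega)
    have h2 := qBinom_succ hq2 (n := n) (i := i) (by omega)
    rw [← ih (by omega)] at h2
    have h3 : (qInt q (i + 1) : ℚ) ≠ 0 := by
      have := two_pow_le_qInt hq2 (i + 1)
      have h4 : 0 < 2 ^ i := by positivity
      rw [pow_succ] at this
      have : 0 < qInt q (i + 1) := by omega
      exact_mod_cast this.ne'
    apply mul_right_cancel₀ h3
    rw [← h2]
    exact_mod_cast h1.symm

end Counting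

/-! ### Random flags, the Lubell function and rerandomization. -/

section Lubell

open scoped Classical

variable {K V : Type*} [Field K] [AddCommGroup V] [Module K V] [FiniteDimensional K V]

/-- The `i`-dimensional member of the image under `g` of the flag `E`. -/
def flagAt (E : ℕ → Submodule K V) (g : V ≃ₗ[K] V) (i : ℕ) : Submodule K V :=
  (E i).map (g : V →ₗ[K] V)

variable {E : ℕ → Submodule K V} {n : ℕ} {F : Finset (Submodule K V)}

lemma flagAt_mono (hE : Monotone E) (g : V ≃ₗ[K] V) : Monotone (flagAt E g) :=
  fun _ _ h => Submodule.map_mono (hE h)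

lemma finrank_flagAt (hr : ∀ i ≤ n, finrank K (E i) = i) (g : V ≃ₗ[K] V) {i : ℕ} (hi : i ≤ n) :
    finrank K (flagAt E g i) = i := by
  rw [← hr i hi, flagAt, LinearEquiv.finrank_map_eq, hr i hi, hr i hi]

lemma flagAt_mul (g h : V ≃ₗ[K] V) (i : ℕ) :
    flagAt E (g * h) i = (flagAt E h i).map (g : V →ₗ[K] V) :=
  map_mul_equiv g h _

/-- Multiplying on the right acts on `E` before `g` does, so an `h` fixing `E j` pointwise changes
the flag only above level `j`. The next lemma is the counterpart for changes below level `i`. -/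
lemma flagAt_mul_of_fix (hE : Monotone E) (g : V ≃ₗ[K] V) {h : V ≃ₗ[K] V} {i j : ℕ} (hij : i ≤ j)
    (hh : ∀ w ∈ E j, h w = w) : flagAt E (g * h) i = flagAt E g i := by
  rw [flagAt_mul, flagAt, map_eq_of_fix (hE hij) hh, flagAt]

lemma flagAt_mul_of_sub_mem (hE : Monotone E) (g : V ≃ₗ[K] V) {h : V ≃ₗ[K] V} {i j : ℕ}
    (hij : i ≤ j) (hh : ∀ w, h w - w ∈ E i) : flagAt E (g * h) j = flagAt E g j := by
  rw [flagAt_mul, flagAt, map_eq_of_sub_mem (hE hij) hh, flagAt]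

lemma flagAt_lt_flagAt (hE : Monotone E) (hr : ∀ i ≤ n, finrank K (E i) = i) (g : V ≃ₗ[K] V)
    {i j : ℕ} (hij : i < j) (hj : j ≤ n) : flagAt E g i < flagAt E g j := by
  refine lt_of_le_of_ne (flagAt_mono hE g hij.le) fun h => ?_
  have := finrank_flagAt hr g hj
  rw [← h, finrank_flagAt hr g (by omega)] at this
  omega

variable [Fintype K] [Fintype (Submodule K V)] [Fintype (V ≃ₗ[K] V)]

/-- Counts of automorphisms related invariantly to a subspace depend only on its dimension. -/
lemma card_mul_levelCard {P : (V ≃ₗ[K] V) → Submodule K V → Prop}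
    (hP : ∀ g₀ g x, P g x → P (g₀ * g) (x.map (g₀ : V →ₗ[K] V))) {i : ℕ} {x : Submodule K V}
    (hx : finrank K x = i) :
    #{g | P g x} * levelCard K V i =
      ∑ g : V ≃ₗ[K] V, #{y : Submodule K V | finrank K y = i ∧ P g y} := by
  have hle : ∀ x y : Submodule K V, finrank K x = finrank K y →
      #{g | P g x} ≤ #{g | P g y} := by
    intro x y hxy
    obtain ⟨g₀, rfl⟩ := exists_equiv_map_eq hxy
    refine card_le_card_of_injOn (fun g => g₀ * g) ?_ (fun a _ b _ h => mul_left_cancel h)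
    intro g hg
    simp only [coe_filter, mem_univ, true_and, Set.mem_ofPred_eq] at hg ⊢
    exact hP _ _ _ hg
  have h := sum_card_bipartiteAbove_eq_sum_card_bipartiteBelow (fun (g : V ≃ₗ[K] V) y => P g y)
    (s := univ) (t := ({y : Submodule K V | finrank K y = i} : Finset _))
  simp only [bipartiteAbove, bipartiteBelow, filter_filter] at h
  rw [h, levelCard, mul_comm, ← smul_eq_mul, ← sum_const]
  refine sum_congr rfl fun y hy => ?_
  simp only [mem_filter, mem_univ, true_and] at hy
  exact le_antisymm (hle _ _ (by omega)) (hle _ _ (by omega))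

/-- Each level of a random flag is uniformly distributed. -/
lemma card_flagAt_eq (hr : ∀ i ≤ n, finrank K (E i) = i) {x : Submodule K V}
    (hx : finrank K x ≤ n) :
    #{g : V ≃ₗ[K] V | flagAt E g (finrank K x) = x} * levelCard K V (finrank K x) =
      Fintype.card (V ≃ₗ[K] V) := by
  refine (card_mul_levelCard (P := fun g y => flagAt E g (finrank K x) = y) ?_ rfl).trans ?_
  · rintro g₀ g y rfl
    exact flagAt_mul _ _ _
  · rw [← card_univ, card_eq_sum_ones]
    refine sum_congr rfl fun g _ => card_eq_one.2 ⟨flagAt E g (finrank K x), ?_⟩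
    ext y
    simp only [mem_filter, mem_univ, true_and, mem_singleton]
    constructor
    · rintro ⟨-, rfl⟩
      rfl
    · rintro rfl
      exact ⟨finrank_flagAt hr g hx, rfl⟩

/-- The Lubell function of a family of subspaces. -/
noncomputable def lubell (F : Finset (Submodule K V)) : ℚ :=
  ∑ x ∈ F, (levelCard K V (finrank K x) : ℚ)⁻¹

/-- The levels at which the flag `g E` meets `F`. -/
noncomputable def hits (E : ℕ → Submodule K V) (n : ℕ) (F : Finset (Submodule K V))
    (g : V ≃ₗ[K] V) : Finset ℕ :=
  {i ∈ range (n + 1) | flagAt E g i ∈ F}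

lemma mem_hits {g : V ≃ₗ[K] V} {i : ℕ} : i ∈ hits E n F g ↔ i ≤ n ∧ flagAt E g i ∈ F := by
  simp [hits]

/-- The Lubell function is the average number of members of the family on a complete flag. -/
lemma card_mul_lubell (hV : finrank K V = n) (hr : ∀ i ≤ n, finrank K (E i) = i) :
    (Fintype.card (V ≃ₗ[K] V) : ℚ) * lubell F = ∑ g : V ≃ₗ[K] V, (#(hits E n F g) : ℚ) := by
  have hn : ∀ x : Submodule K V, finrank K x ≤ n := fun x => hV ▸ Submodule.finrank_le x
  have h1 : ∀ g : V ≃ₗ[K] V,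
      #(hits E n F g) = #(F.filter fun x : Submodule K V => flagAt E g (finrank K x) = x) := by
    intro g
    refine card_bij (fun (i : ℕ) _ => (flagAt E g i : Submodule K V)) ?_ ?_ ?_
    · intro i hi
      rw [mem_hits] at hi
      simp only [mem_filter]
      exact ⟨hi.2, by rw [finrank_flagAt hr g hi.1]⟩
    · intro i hi j hj h
      rw [mem_hits] at hi hj
      have h' := finrank_flagAt hr g hi.1
      rwa [show flagAt E g i = flagAt E g j from h, finrank_flagAt hr g hj.1, eq_comm] at h'
    · intro x hx
      simp only [mem_filter] at hx
      refine ⟨finrank K x, ?_, hx.2⟩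
      rw [mem_hits, hx.2]
      exact ⟨hn x, hx.1⟩
  have h2 := sum_card_bipartiteAbove_eq_sum_card_bipartiteBelow
    (fun (g : V ≃ₗ[K] V) (x : Submodule K V) => flagAt E g (finrank K x) = x) (s := univ) (t := F)
  simp only [bipartiteAbove, bipartiteBelow] at h2
  rw [← Nat.cast_sum, sum_congr rfl fun g _ => h1 g, h2, lubell, mul_sum, Nat.cast_sum]
  refine sum_congr rfl fun x _ => ?_
  have h3 := levelCard_pos hV (hn x)
  rw [← card_flagAt_eq hr (hn x), Nat.cast_mul, mul_inv_cancel_right₀]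
  exact_mod_cast h3.ne'

/-- The rerandomization principle. Each `w ∈ W` can replace `E l` without leaving `T`: right
multiplication by `h` injects the `g ∈ T` with `g (E l) ∈ F` into those with `g w ∈ F`. A given `g`
sends at most one `w` into `F`, so the event has frequency at most `1 / #W` in `T`. -/
lemma card_mul_card_flagAt_le {T : Finset (V ≃ₗ[K] V)} {W : Finset (Submodule K V)} {l : ℕ}
    (hW : ∀ w ∈ W, ∃ h : V ≃ₗ[K] V, (∀ g ∈ T, g * h ∈ T) ∧ w.map (h : V →ₗ[K] V) = E l)
    (hu : ∀ g ∈ T, ∀ w ∈ W, ∀ w' ∈ W, w.map (g : V →ₗ[K] V) ∈ F → w'.map (g : V →ₗ[K] V) ∈ F →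
      w = w') : #W * #{g ∈ T | flagAt E g l ∈ F} ≤ #T := by
  have h2 := card_mul_le_card_mul (s := W) (t := T)
    (fun w (g : V ≃ₗ[K] V) => w.map (g : V →ₗ[K] V) ∈ F)
    (m := #{g ∈ T | flagAt E g l ∈ F}) (n := 1) ?_ ?_
  · simpa using h2
  · intro w hw
    obtain ⟨h, hT, hh⟩ := hW w hw
    refine card_le_card_of_injOn (fun g => g * h) ?_ (fun a _ b _ h => mul_right_cancel h)
    intro g hg
    simp only [coe_filter, Set.mem_ofPred_eq, bipartiteAbove] at hg ⊢
    refine ⟨hT g hg.1, ?_⟩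
    rw [map_mul_equiv, hh]
    exact hg.2
  · intro g hg
    refine card_le_one.2 fun w hw w' hw' => ?_
    simp only [mem_filter, bipartiteBelow] at hw hw'
    exact hu g hg w hw.1 w' hw'.1 hw.2 hw'.2

/-- At most `m` levels, each hit with frequency at most `1 / (2 m)`, give `1/2` in the mean. -/
lemma two_mul_sum_le_of_forall {α : Type*} {T : Finset α} {I : Finset ℕ} {m : ℕ}
    {p : α → ℕ → Prop} [∀ a l, Decidable (p a l)] (hI : #I ≤ m) (h : ∀ l ∈ I, 2 * m * #{g ∈ T | p g l} ≤ #T) :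
    2 * ∑ g ∈ T, #{l ∈ I | p g l} ≤ #T := by
  rcases I.eq_empty_or_nonempty with rfl | hne
  · simp
  have hm : 0 < m := lt_of_lt_of_le hne.card_pos hI
  have h2 := sum_card_bipartiteAbove_eq_sum_card_bipartiteBelow p (s := T) (t := I)
  simp only [bipartiteAbove, bipartiteBelow] at h2
  rw [h2]
  have h3 := sum_le_sum h
  rw [← mul_sum, sum_const, smul_eq_mul] at h3
  have h4 : #I * #T ≤ m * #T := Nat.mul_le_mul_right _ hI
  refine le_of_mul_le_mul_left (a := m) ?_ hm
  linarith

/-- If, for the flags in a set invariant under changes above level `j`, the members of `F` above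
the `j`-th level form a chain, then on average there are at most `1/2` of them. -/
lemma two_mul_sum_hits_above_le (hV : finrank K V = n) (hE : Monotone E)
    (hr : ∀ i ≤ n, finrank K (E i) = i) (hF : ⊤ ∉ F)
    {T : Finset (V ≃ₗ[K] V)} {j : ℕ} (hT : ∀ g ∈ T, ∀ h : V ≃ₗ[K] V, (∀ w ∈ E j, h w = w) → g * h ∈ T)
    (hc : ∀ g ∈ T, ∀ x ∈ F, ∀ y ∈ F, flagAt E g j < x → flagAt E g j < y → x ≤ y ∨ y ≤ x) :
    2 * ∑ g ∈ T, #{l ∈ hits E n F g | j < l} ≤ #T := by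
  have h1 : ∀ g ∈ T, #{l ∈ hits E n F g | j < l} = #{l ∈ Ioo j n | flagAt E g l ∈ F} := by
    intro g _
    congr 1
    ext l
    simp only [mem_filter, mem_hits, mem_Ioo]
    have : flagAt E g l ∈ F → l ≤ n → l < n := by
      intro hl hln
      refine lt_of_le_of_ne hln ?_
      rintro rfl
      refine hF ?_
      rwa [← Submodule.eq_top_of_finrank_eq ((finrank_flagAt hr g le_rfl).trans hV.symm)]
    grind
  rw [sum_congr rfl h1]
  -- `n - j - 1` levels lie strictly between `j` and `n`, and `two_mul_le_card_level` gives each of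
  -- them twice as many candidates above `E j`.
  refine two_mul_sum_le_of_forall (m := n - j - 1) (by simp) fun l hl => ?_
  rw [mem_Ioo] at hl
  have hj := hr j (by omega)
  have h2 := two_mul_le_card_level (K := K) (V := V) rfl (u := E j) (v := ⊤) le_top (l := l)
    (by omega) (by rw [finrank_top]; omega)
  rw [finrank_top, hV, hj] at h2
  refine (Nat.mul_le_mul_right _ h2).trans (card_mul_card_flagAt_le ?_ ?_)
  · intro w hw
    simp only [mem_filter, mem_univ, true_and] at hw
    obtain ⟨h, hh, hw'⟩ := exists_equiv_map_eq_of_ge hw.1 (hE hl.1.le)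
      (hw.2.2.trans (hr l hl.2.le).symm)
    exact ⟨h, fun g hg => hT g hg h hh, hw'⟩
  · intro g hg w hw w' hw' h h'
    simp only [mem_filter, mem_univ, true_and] at hw hw'
    have key : ∀ w : Submodule K V, E j ≤ w → finrank K w = l →
        flagAt E g j < w.map (g : V →ₗ[K] V) := fun w hw hwl =>
      lt_of_le_of_ne (Submodule.map_mono hw) fun h => by
        have := map_equiv_injective g h
        subst this
        omega
    refine map_equiv_injective g (eq_of_comparable_of_finrank_eq (hc g hg _ h _ h'
      (key w hw.1 hw.2.2) (key w' hw'.1 hw'.2.2)) ?_)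
    rw [LinearEquiv.finrank_map_eq, LinearEquiv.finrank_map_eq, hw.2.2, hw'.2.2]

/-- If, for the flags in a set invariant under changes below level `i`, the members of `F` below
the `i`-th level form a chain, then on average there are at most `1/2` of them. -/
lemma two_mul_sum_hits_below_le (hE : Monotone E)
    (hr : ∀ i ≤ n, finrank K (E i) = i) (hF : ⊥ ∉ F)
    {T : Finset (V ≃ₗ[K] V)} {i : ℕ} (hin : i ≤ n)
    (hT : ∀ g ∈ T, ∀ h : V ≃ₗ[K] V, (∀ w, h w - w ∈ E i) → g * h ∈ T)
    (hc : ∀ g ∈ T, ∀ x ∈ F, ∀ y ∈ F, x < flagAt E g i → y < flagAt E g i → x ≤ y ∨ y ≤ x) :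
    2 * ∑ g ∈ T, #{l ∈ hits E n F g | l < i} ≤ #T := by
  have h1 : ∀ g ∈ T, #{l ∈ hits E n F g | l < i} = #{l ∈ Ioo 0 i | flagAt E g l ∈ F} := by
    intro g _
    congr 1
    ext l
    simp only [mem_filter, mem_hits, mem_Ioo]
    have : flagAt E g l ∈ F → 0 < l := by
      intro hl
      rw [Nat.pos_iff_ne_zero]
      rintro rfl
      refine hF ?_
      rwa [← Submodule.finrank_eq_zero.1 (finrank_flagAt hr g (Nat.zero_le n))]
    grind
  rw [sum_congr rfl h1]
  refine two_mul_sum_le_of_forall (m := i - 1) (by simp) fun l hl => ?_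
  rw [mem_Ioo] at hl
  have hi := hr i (by omega)
  have h2 := two_mul_le_card_level (K := K) (V := V) rfl (u := ⊥) (v := E i) bot_le (l := l)
    (by simpa using hl.1) (by omega)
  rw [finrank_bot, hi, Nat.sub_zero] at h2
  refine (Nat.mul_le_mul_right _ h2).trans (card_mul_card_flagAt_le ?_ ?_)
  · intro w hw
    simp only [mem_filter, mem_univ, true_and] at hw
    obtain ⟨h, hh, hw'⟩ := exists_equiv_map_eq_of_le hw.2.1 (hE hl.2.le)
      (hw.2.2.trans (hr l (by omega)).symm)
    exact ⟨h, fun g hg => hT g hg h hh, hw'⟩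
  · intro g hg w hw w' hw' h h'
    simp only [mem_filter, mem_univ, true_and] at hw hw'
    have key : ∀ w : Submodule K V, w ≤ E i → finrank K w = l →
        w.map (g : V →ₗ[K] V) < flagAt E g i := fun w hw hwl =>
      lt_of_le_of_ne (Submodule.map_mono hw) fun h => by
        have := map_equiv_injective g h
        subst this
        omega
    refine map_equiv_injective g (eq_of_comparable_of_finrank_eq (hc g hg _ h _ h'
      (key w hw.2.1 hw.2.2) (key w' hw'.2.1 hw'.2.2)) ?_)
    rw [LinearEquiv.finrank_map_eq, LinearEquiv.finrank_map_eq, hw.2.2, hw'.2.2]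

end Lubell

/-! ### The comparability conditions extracted from freeness. -/

section Free

/-- Any two members of `F` above a `k`-element chain of `F` are comparable. -/
def UpFree {α : Type*} [PartialOrder α] (k : ℕ) (F : Finset α) : Prop :=
  ∀ s ⊆ F, IsChain (· ≤ ·) (s : Set α) → #s = k → ∀ y ∈ F, ∀ z ∈ F,
    (∀ x ∈ s, x < y) → (∀ x ∈ s, x < z) → y ≤ z ∨ z ≤ y

/-- Any two members of `F` below a `k`-element chain of `F` are comparable. -/
def DownFree {α : Type*} [PartialOrder α] (k : ℕ) (F : Finset α) : Prop :=
  ∀ s ⊆ F, IsChain (· ≤ ·) (s : Set α) → #s = k → ∀ y ∈ F, ∀ z ∈ F,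
    (∀ x ∈ s, y < x) → (∀ x ∈ s, z < x) → y ≤ z ∨ z ≤ y

lemma exists_mem_card_filter_le_eq {m : ℕ} (hm : 1 ≤ m) (A : Finset ℕ) (hA : m ≤ #A) :
    ∃ j ∈ A, #{x ∈ A | x ≤ j} = m := by
  induction A using Finset.induction_on_max with
  | empty => simp at hA; omega
  | insert a s has ih =>
    have ha : a ∉ s := fun h => lt_irrefl _ (has a h)
    rw [card_insert_of_notMem ha] at hA
    rcases hA.lt_or_eq with h | h
    · obtain ⟨j, hj, hjm⟩ := ih (by omega)
      refine ⟨j, mem_insert_of_mem hj, ?_⟩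
      rw [filter_insert, if_neg (by have := has j hj; omega), hjm]
    · refine ⟨a, mem_insert_self _ _, ?_⟩
      rw [h, ← card_insert_of_notMem ha, filter_true_of_mem]
      intro x hx
      rcases mem_insert.1 hx with rfl | hx
      · exact le_rfl
      · exact (has x hx).le

end Free

/-! ### Windows on a flag and the Lubell bounds away from `⊥` and `⊤`. -/

section Windows

open scoped Classical

variable {K V : Type*} [Field K] [AddCommGroup V] [Module K V] [FiniteDimensional K V]
  [Fintype K] [Fintype (Submodule K V)] [Fintype (V ≃ₗ[K] V)]
  {E : ℕ → Submodule K V} {n : ℕ} {F : Finset (Submodule K V)}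

lemma image_flagAt_hits (hE : Monotone E) (hr : ∀ i ≤ n, finrank K (E i) = i)
    {g : V ≃ₗ[K] V} {I : Finset ℕ} (hI : I ⊆ hits E n F g) :
    I.image (flagAt E g) ⊆ F ∧
      IsChain (· ≤ ·) (I.image (flagAt E g) : Set (Submodule K V)) ∧
      #(I.image (flagAt E g)) = #I := by
  refine ⟨fun x hx => ?_, ?_, card_image_of_injOn ?_⟩
  · obtain ⟨i, hi, rfl⟩ := mem_image.1 hx
    exact (mem_hits.1 (hI hi)).2
  · intro x hx y hy _
    rw [mem_coe] at hx hy
    obtain ⟨i, hi, rfl⟩ := mem_image.1 hx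
    obtain ⟨j, hj, rfl⟩ := mem_image.1 hy
    exact (le_total i j).imp (fun h => flagAt_mono hE g h) fun h => flagAt_mono hE g h
  · intro i hi j hj h
    have hi' := finrank_flagAt hr g (mem_hits.1 (hI hi)).1
    rwa [h, finrank_flagAt hr g (mem_hits.1 (hI hj)).1, eq_comm] at hi'

/-- A family with `UpFree m` has Lubell function at most `m + 1/2`. -/
lemma lubell_le_of_upFree (hV : finrank K V = n) {m : ℕ} (hm : 1 ≤ m) (hF : UpFree m F)
    (htop : ⊤ ∉ F) : lubell F ≤ m + 1 / 2 := by
  obtain ⟨E, hE, hr⟩ := exists_flag hV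
  -- `T j` collects the flags whose `m`-th member of `F` from below is at level `j`. This depends
  -- only on levels up to `j`, so the flag may be rerandomized above `j`.
  set T : ℕ → Finset (V ≃ₗ[K] V) := fun j =>
    {g | j ∈ hits E n F g ∧ #{l ∈ hits E n F g | l ≤ j} = m} with hTdef
  have hT : ∀ {j g}, g ∈ T j ↔ j ∈ hits E n F g ∧ #{l ∈ hits E n F g | l ≤ j} = m := by
    simp [hTdef]
  have hsplit : ∀ (g : V ≃ₗ[K] V) j, #(hits E n F g) =
      #{l ∈ hits E n F g | l ≤ j} + #{l ∈ hits E n F g | j < l} := by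
    intro g j
    rw [← card_filter_add_card_filter_not (fun l => l ≤ j)]
    simp
  have hup : ∀ j, 2 * ∑ g ∈ T j, #{l ∈ hits E n F g | j < l} ≤ #(T j) := by
    intro j
    refine two_mul_sum_hits_above_le hV hE hr htop ?_ ?_
    · intro g hg h hh
      have heq : ∀ l ≤ j, (l ∈ hits E n F (g * h) ↔ l ∈ hits E n F g) := by
        intro l hl
        rw [mem_hits, mem_hits, flagAt_mul_of_fix hE g hl hh]
      rw [hT] at hg ⊢
      refine ⟨(heq j le_rfl).2 hg.1, ?_⟩
      rw [← hg.2]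
      congr 1
      ext l
      simp only [mem_filter]
      have := heq l
      tauto
    · intro g hg x hx y hy hgx hgy
      rw [hT] at hg
      obtain ⟨h1, h2, h3⟩ := image_flagAt_hits (F := F) hE hr
        (filter_subset (fun l => l ≤ j) (hits E n F g))
      refine hF _ h1 h2 (h3.trans hg.2) x hx y hy ?_ ?_
      all_goals
        intro w hw
        obtain ⟨i, hi, rfl⟩ := mem_image.1 hw
        exact (flagAt_mono hE g (mem_filter.1 hi).2).trans_lt ‹_›
  have hdisj : Set.PairwiseDisjoint (range (n + 1) : Set ℕ) T := by
    have key : ∀ g i j, g ∈ T i → g ∈ T j → i < j → False := by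
      intro g i j hi hj hij
      rw [hT] at hi hj
      have : #{l ∈ hits E n F g | l ≤ i} < #{l ∈ hits E n F g | l ≤ j} := by
        refine card_lt_card (ssubset_iff_of_subset ?_ |>.2 ⟨j, by simp [hj.1], by simp; omega⟩)
        exact monotone_filter_right _ fun l _ (hl : l ≤ i) => hl.trans hij.le
      omega
    intro i _ j _ hij
    rw [Function.onFun, disjoint_left]
    intro g hi hj
    rcases lt_or_gt_of_ne hij with h | h
    · exact key g i j hi hj h
    · exact key g j i hj hi h
  set U := (range (n + 1)).biUnion T with hU
  have h1 : 2 * ∑ g ∈ U, #(hits E n F g) ≤ (2 * m + 1) * #U := by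
    rw [hU, sum_biUnion hdisj, card_biUnion hdisj, mul_sum, mul_sum]
    refine sum_le_sum fun j _ => ?_
    rw [sum_congr rfl fun g hg => (hsplit g j).trans (by rw [(hT.1 hg).2]), sum_add_distrib,
      sum_const, smul_eq_mul]
    have := hup j
    linarith
  have h2 : 2 * ∑ g ∈ Uᶜ, #(hits E n F g) ≤ (2 * m + 1) * #Uᶜ := by
    rw [mul_sum, mul_comm, ← smul_eq_mul, ← sum_const]
    refine sum_le_sum fun g hg => ?_
    by_contra hcon
    obtain ⟨j, hj, hjm⟩ := exists_mem_card_filter_le_eq hm (hits E n F g) (by omega)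
    rw [mem_compl, hU] at hg
    exact hg (mem_biUnion.2 ⟨j, mem_range.2 (by have := (mem_hits.1 hj).1; omega), hT.2 ⟨hj, hjm⟩⟩)
  have h3 := sum_add_sum_compl U fun g => #(hits E n F g)
  have h4 := card_add_card_compl U
  have h5 : 2 * ∑ g : V ≃ₗ[K] V, #(hits E n F g) ≤ (2 * m + 1) * Fintype.card (V ≃ₗ[K] V) := by
    rw [← h3, ← h4]
    linarith
  have h6 := card_mul_lubell (F := F) hV hr
  have h7 : (0 : ℚ) < Fintype.card (V ≃ₗ[K] V) := by exact_mod_cast Fintype.card_pos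
  have h8 : (2 : ℚ) * ∑ g : V ≃ₗ[K] V, (#(hits E n F g) : ℚ) ≤
      (2 * m + 1) * Fintype.card (V ≃ₗ[K] V) := by exact_mod_cast h5
  rw [← h6] at h8
  refine le_of_mul_le_mul_left ?_ h7
  linarith

/-- The automorphisms `g` for which `m` members of `F` lie on the flag `g E` between the levels
`i` and `j`, the first one being the `i`-th member of the flag and not minimal in `F`, the last one
being the `j`-th member of the flag and not maximal in `F`. -/
noncomputable def windowAuts (E : ℕ → Submodule K V) (n : ℕ) (F : Finset (Submodule K V))
    (m i j : ℕ) : Finset (V ≃ₗ[K] V) :=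
  {g | (i ∈ hits E n F g ∧ ∃ x ∈ F, x < flagAt E g i) ∧
    (j ∈ hits E n F g ∧ ∃ y ∈ F, flagAt E g j < y) ∧ #{l ∈ hits E n F g | i ≤ l ∧ l ≤ j} = m}

lemma mem_windowAuts {m i j : ℕ} {g : V ≃ₗ[K] V} : g ∈ windowAuts E n F m i j ↔
    (i ∈ hits E n F g ∧ ∃ x ∈ F, x < flagAt E g i) ∧
    (j ∈ hits E n F g ∧ ∃ y ∈ F, flagAt E g j < y) ∧
      #{l ∈ hits E n F g | i ≤ l ∧ l ≤ j} = m := by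
  simp [windowAuts]

/-- Minimality and maximality are taken in all of `F`, not on the flag; hence being a window
survives rerandomization both below `i` and above `j`. -/
lemma windowAuts_congr {m i j : ℕ} (hij : i ≤ j) {g g' : V ≃ₗ[K] V}
    (h : ∀ l, i ≤ l → l ≤ j → flagAt E g' l = flagAt E g l) (hg : g ∈ windowAuts E n F m i j) :
    g' ∈ windowAuts E n F m i j := by
  have heq : ∀ l, i ≤ l → l ≤ j → (l ∈ hits E n F g' ↔ l ∈ hits E n F g) := by
    intro l hl hl'
    rw [mem_hits, mem_hits, h l hl hl']
  rw [mem_windowAuts] at hg ⊢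
  rw [heq i le_rfl hij, heq j hij le_rfl, h i le_rfl hij, h j hij le_rfl]
  refine ⟨hg.1, hg.2.1, ?_⟩
  rw [← hg.2.2]
  congr 1
  ext l
  simp only [mem_filter]
  have := heq l
  tauto

/-- The `m` members in the window, together with a member of `F` below the first of them, form the
chain of `m + 1` to which `UpFree` applies. -/
lemma comparable_above_of_mem_windowAuts (hE : Monotone E) (hr : ∀ i ≤ n, finrank K (E i) = i)
    {m i j : ℕ} (hij : i ≤ j) (hF : UpFree (m + 1) F) {g : V ≃ₗ[K] V}
    (hg : g ∈ windowAuts E n F m i j) {x y : Submodule K V} (hx : x ∈ F) (hy : y ∈ F)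
    (hgx : flagAt E g j < x) (hgy : flagAt E g j < y) : x ≤ y ∨ y ≤ x := by
  obtain ⟨⟨-, z, hz, hzi⟩, -, hcard⟩ := mem_windowAuts.1 hg
  obtain ⟨h1, h2, h3⟩ := image_flagAt_hits (F := F) hE hr
    (filter_subset (fun l => i ≤ l ∧ l ≤ j) (hits E n F g))
  have hlt : ∀ w ∈ image (flagAt E g) {l ∈ hits E n F g | i ≤ l ∧ l ≤ j},
      z < w ∧ w ≤ flagAt E g j := by
    intro w hw
    obtain ⟨l, hl, rfl⟩ := mem_image.1 hw
    rw [mem_filter] at hl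
    exact ⟨hzi.trans_le (flagAt_mono hE g hl.2.1), flagAt_mono hE g hl.2.2⟩
  refine hF (insert z (image (flagAt E g) {l ∈ hits E n F g | i ≤ l ∧ l ≤ j}))
    (insert_subset hz h1) ?_ ?_ x hx y hy ?_ ?_
  · rw [coe_insert]
    exact h2.insert fun w hw _ => Or.inl (hlt w hw).1.le
  · rw [card_insert_of_notMem fun h => lt_irrefl _ (hlt z h).1, h3, hcard]
  all_goals
    intro w hw
    rcases mem_insert.1 hw with rfl | hw
    · exact (hzi.trans_le (flagAt_mono hE g hij)).trans ‹_›
    · exact (hlt w hw).2.trans_lt ‹_›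

lemma comparable_below_of_mem_windowAuts (hE : Monotone E) (hr : ∀ i ≤ n, finrank K (E i) = i)
    {m i j : ℕ} (hij : i ≤ j) (hF : DownFree (m + 1) F) {g : V ≃ₗ[K] V}
    (hg : g ∈ windowAuts E n F m i j) {x y : Submodule K V} (hx : x ∈ F) (hy : y ∈ F)
    (hgx : x < flagAt E g i) (hgy : y < flagAt E g i) : x ≤ y ∨ y ≤ x := by
  obtain ⟨-, ⟨-, z, hz, hzi⟩, hcard⟩ := mem_windowAuts.1 hg
  obtain ⟨h1, h2, h3⟩ := image_flagAt_hits (F := F) hE hr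
    (filter_subset (fun l => i ≤ l ∧ l ≤ j) (hits E n F g))
  have hlt : ∀ w ∈ image (flagAt E g) {l ∈ hits E n F g | i ≤ l ∧ l ≤ j},
      w < z ∧ flagAt E g i ≤ w := by
    intro w hw
    obtain ⟨l, hl, rfl⟩ := mem_image.1 hw
    rw [mem_filter] at hl
    exact ⟨(flagAt_mono hE g hl.2.2).trans_lt hzi, flagAt_mono hE g hl.2.1⟩
  refine hF (insert z (image (flagAt E g) {l ∈ hits E n F g | i ≤ l ∧ l ≤ j}))
    (insert_subset hz h1) ?_ ?_ x hx y hy ?_ ?_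
  · rw [coe_insert]
    exact h2.insert fun w hw _ => Or.inr (hlt w hw).1.le
  · rw [card_insert_of_notMem fun h => lt_irrefl _ (hlt z h).1, h3, hcard]
  all_goals
    intro w hw
    rcases mem_insert.1 hw with rfl | hw
    · exact lt_of_lt_of_le ‹_› ((flagAt_mono hE g hij).trans hzi.le)
    · exact lt_of_lt_of_le ‹_› (hlt w hw).2

/-- The automorphisms in a window below which all members of `F` on the flag are minimal. -/
noncomputable def firstWindowAuts (E : ℕ → Submodule K V) (n : ℕ) (F : Finset (Submodule K V))
    (m i j : ℕ) : Finset (V ≃ₗ[K] V) :=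
  {g ∈ windowAuts E n F m i j | ∀ l ∈ hits E n F g, l < i → ∀ x ∈ F, ¬ x < flagAt E g l}

lemma mem_firstWindowAuts {m i j : ℕ} {g : V ≃ₗ[K] V} : g ∈ firstWindowAuts E n F m i j ↔
    g ∈ windowAuts E n F m i j ∧ ∀ l ∈ hits E n F g, l < i → ∀ x ∈ F, ¬ x < flagAt E g l := by
  simp [firstWindowAuts]

lemma two_mul_sum_above_firstWindowAuts_le (hV : finrank K V = n) (hE : Monotone E)
    (hr : ∀ i ≤ n, finrank K (E i) = i) {m i j : ℕ} (hij : i ≤ j) (hF : UpFree (m + 1) F)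
    (htop : ⊤ ∉ F) :
    2 * ∑ g ∈ firstWindowAuts E n F m i j, #{l ∈ hits E n F g | j < l} ≤
      #(firstWindowAuts E n F m i j) := by
  refine two_mul_sum_hits_above_le hV hE hr htop ?_ ?_
  · intro g hg h hh
    rw [mem_firstWindowAuts] at hg ⊢
    have heq : ∀ l ≤ j, flagAt E (g * h) l = flagAt E g l := fun l hl =>
      flagAt_mul_of_fix hE g hl hh
    refine ⟨windowAuts_congr hij (fun l _ hl => heq l hl) hg.1, fun l hl hli => ?_⟩
    rw [mem_hits, heq l (by omega)] at hl
    rw [heq l (by omega)]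
    exact hg.2 l (mem_hits.2 hl) hli
  · intro g hg x hx y hy
    exact comparable_above_of_mem_windowAuts hE hr hij hF (mem_firstWindowAuts.1 hg).1 hx hy

/-- Of two members of `F` on the flag below `i`, the larger would not be minimal. -/
lemma card_below_le_one_of_mem_firstWindowAuts (hE : Monotone E)
    (hr : ∀ i ≤ n, finrank K (E i) = i) {m i j : ℕ} {g : V ≃ₗ[K] V}
    (hg : g ∈ firstWindowAuts E n F m i j) : #{l ∈ hits E n F g | l < i} ≤ 1 := by
  have key : ∀ a b, a ∈ hits E n F g → b ∈ hits E n F g → b < i → a < b → False :=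
    fun a b ha hb hbi hab => (mem_firstWindowAuts.1 hg).2 b hb hbi _ (mem_hits.1 ha).2
      (flagAt_lt_flagAt hE hr g hab (mem_hits.1 hb).1)
  refine card_le_one.2 fun a ha b hb => ?_
  rw [mem_filter] at ha hb
  by_contra hne
  rcases lt_or_gt_of_ne hne with h | h
  · exact key a b ha.1 hb.1 hb.2 h
  · exact key b a hb.1 ha.1 ha.2 h

/-- Rerandomizing below `i` may destroy the "first window" condition, so the mean is bounded on the
set `S` of all windows. There at least half of the flags have no member below `i`, and all of these
lie in `T`. The other flags of `T` have only one such member, so the mean on `T` is also at most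
`1/2`. -/
lemma two_mul_sum_below_firstWindowAuts_le (hE : Monotone E)
    (hr : ∀ i ≤ n, finrank K (E i) = i) {m i j : ℕ} (hij : i ≤ j) (hin : i ≤ n)
    (hF : DownFree (m + 1) F) (hbot : ⊥ ∉ F) :
    2 * ∑ g ∈ firstWindowAuts E n F m i j, #{l ∈ hits E n F g | l < i} ≤
      #(firstWindowAuts E n F m i j) := by
  set S := windowAuts E n F m i j
  set T := firstWindowAuts E n F m i j with hT
  set low : (V ≃ₗ[K] V) → ℕ := fun g => #{l ∈ hits E n F g | l < i} with hlow
  have hS : 2 * ∑ g ∈ S, low g ≤ #S := by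
    refine two_mul_sum_hits_below_le hE hr hbot hin ?_ ?_
    · intro g hg h hh
      exact windowAuts_congr hij (fun l hl _ => flagAt_mul_of_sub_mem hE g hl hh) hg
    · intro g hg x hx y hy
      exact comparable_below_of_mem_windowAuts hE hr hij hF hg hx hy
  have hTS : T ⊆ S := filter_subset _ _
  have hNT : S.filter (fun g => low g = 0) ⊆ T := by
    intro g hg
    rw [mem_filter, hlow, card_eq_zero, filter_eq_empty_iff] at hg
    exact mem_firstWindowAuts.2 ⟨hg.1, fun l hl hli => absurd hli (hg.2 hl)⟩
  have h1 : #S ≤ #(S.filter fun g => low g = 0) + ∑ g ∈ S, low g := by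
    rw [card_filter, ← sum_add_distrib, card_eq_sum_ones]
    refine sum_le_sum fun g _ => ?_
    split_ifs <;> omega
  have h2 : ∑ g ∈ T, low g + #(S.filter fun g => low g = 0) ≤ #T := by
    have : S.filter (fun g => low g = 0) = T.filter (fun g => low g = 0) := by
      apply Subset.antisymm
      · intro g hg
        exact mem_filter.2 ⟨hNT hg, (mem_filter.1 hg).2⟩
      · exact filter_subset_filter _ hTS
    rw [this, card_filter, ← sum_add_distrib, card_eq_sum_ones]
    refine sum_le_sum fun g hg => ?_
    have := card_below_le_one_of_mem_firstWindowAuts hE hr hg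
    change low g ≤ 1 at this
    split_ifs <;> omega
  have h3 := card_le_card hTS
  change 2 * ∑ g ∈ T, low g ≤ #T
  omega

/-- Let `i` be the lowest hit not minimal in `F`. At most one hit is below it, so at least `m + 1`
start at `i`; `j` is the `m`-th of these, and the next one shows that level `j` is not maximal. -/
lemma exists_mem_firstWindowAuts (hE : Monotone E) (hr : ∀ i ≤ n, finrank K (E i) = i) {m : ℕ}
    (hm : 1 ≤ m) {g : V ≃ₗ[K] V} (hg : m + 2 ≤ #(hits E n F g)) :
    ∃ i j, i ≤ j ∧ j ≤ n ∧ g ∈ firstWindowAuts E n F m i j := by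
  have hlt : ∀ {a b}, b ∈ hits E n F g → a < b → flagAt E g a < flagAt E g b := fun hb hab =>
    flagAt_lt_flagAt hE hr g hab (mem_hits.1 hb).1
  set N : Finset ℕ := {l ∈ hits E n F g | ∃ x ∈ F, x < flagAt E g l} with hN
  have hmemN : ∀ {a b}, a ∈ hits E n F g → b ∈ hits E n F g → a < b → b ∈ N :=
    fun {a b} ha hb hab => mem_filter.2 ⟨hb, _, (mem_hits.1 ha).2, hlt hb hab⟩
  have hNne : N.Nonempty := by
    obtain ⟨a, ha, b, hb, hab⟩ := one_lt_card.1 (show 1 < #(hits E n F g) by omega)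
    rcases lt_or_gt_of_ne hab with h | h
    · exact ⟨b, hmemN ha hb h⟩
    · exact ⟨a, hmemN hb ha h⟩
  set i := N.min' hNne with hi
  have hiN : i ∈ N := N.min'_mem hNne
  have hmin : ∀ l ∈ N, i ≤ l := fun l hl => N.min'_le l hl
  have hlow : #{l ∈ hits E n F g | ¬ i ≤ l} ≤ 1 := by
    refine card_le_one.2 fun a ha b hb => ?_
    rw [mem_filter] at ha hb
    by_contra hne
    rcases lt_or_gt_of_ne hne with h | h
    · exact hb.2 (hmin b (hmemN ha.1 hb.1 h))
    · exact ha.2 (hmin a (hmemN hb.1 ha.1 h))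
  have hsplit := card_filter_add_card_filter_not (s := hits E n F g) (fun l => i ≤ l)
  obtain ⟨j, hj, hjm⟩ := exists_mem_card_filter_le_eq hm {l ∈ hits E n F g | i ≤ l} (by omega)
  have hj' := mem_filter.1 hj
  obtain ⟨l, hl, hjl⟩ : ∃ l ∈ ({l ∈ hits E n F g | i ≤ l} : Finset ℕ), j < l := by
    by_contra! hcon
    rw [filter_true_of_mem hcon] at hjm
    omega
  rw [filter_filter] at hjm
  have hl' := (mem_filter.1 hl).1
  refine ⟨i, j, hj'.2, (mem_hits.1 hj'.1).1, mem_firstWindowAuts.2 ⟨mem_windowAuts.2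
    ⟨mem_filter.1 hiN, ⟨hj'.1, _, (mem_hits.1 hl').2, hlt hl' hjl⟩, hjm⟩, ?_⟩⟩
  intro l hl hli x hx hxl
  have := hmin l (mem_filter.2 ⟨hl, x, hx, hxl⟩)
  omega

/-- Makes the first windows for different `(i, j)` disjoint, so that the means over them can be
added. -/
lemma firstWindowAuts_unique {m i j i' j' : ℕ} {g : V ≃ₗ[K] V}
    (hg : g ∈ firstWindowAuts E n F m i j) (hij' : i' ≤ j')
    (hg' : g ∈ firstWindowAuts E n F m i' j') : ¬ i < i' ∧ ¬ (i = i' ∧ j < j') := by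
  obtain ⟨hw, -⟩ := mem_firstWindowAuts.1 hg
  obtain ⟨hw', hmin⟩ := mem_firstWindowAuts.1 hg'
  obtain ⟨⟨hi, x, hx, hxi⟩, -, hc⟩ := mem_windowAuts.1 hw
  obtain ⟨-, ⟨hj', -⟩, hc'⟩ := mem_windowAuts.1 hw'
  refine ⟨fun h => hmin i hi h x hx hxi, ?_⟩
  rintro ⟨rfl, h⟩
  have : #{l ∈ hits E n F g | i ≤ l ∧ l ≤ j} < #{l ∈ hits E n F g | i ≤ l ∧ l ≤ j'} := by
    refine card_lt_card (ssubset_iff_of_subset ?_ |>.2 ⟨j', by simp [hj', hij'], by simp; omega⟩)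
    exact monotone_filter_right _ fun l _ (hl : i ≤ l ∧ l ≤ j) => ⟨hl.1, hl.2.trans h.le⟩
  omega

/-- A family with `UpFree k` and `DownFree k`, `k ≥ 2`, has Lubell function at most `k`. -/
lemma lubell_le_of_upFree_of_downFree (hV : finrank K V = n) {m : ℕ} (hm : 1 ≤ m)
    (hup : UpFree (m + 1) F) (hdown : DownFree (m + 1) F) (hbot : ⊥ ∉ F) (htop : ⊤ ∉ F) :
    lubell F ≤ m + 1 := by
  obtain ⟨E, hE, hr⟩ := exists_flag hV
  set P : Finset (ℕ × ℕ) := {p ∈ range (n + 1) ×ˢ range (n + 1) | p.1 ≤ p.2} with hP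
  have hmemP : ∀ {p}, p ∈ P ↔ p.1 ≤ p.2 ∧ p.2 ≤ n := by
    intro p
    simp only [hP, mem_filter, mem_product, mem_range]
    omega
  set T : ℕ × ℕ → Finset (V ≃ₗ[K] V) := fun p => firstWindowAuts E n F m p.1 p.2
  have hdisj : Set.PairwiseDisjoint (P : Set (ℕ × ℕ)) T := by
    intro p hp p' hp' hne
    rw [Function.onFun, disjoint_left]
    intro g hg hg'
    have h1 := firstWindowAuts_unique hg (hmemP.1 hp').1 hg'
    have h2 := firstWindowAuts_unique hg' (hmemP.1 hp).1 hg
    exact hne (Prod.ext (by omega) (by omega))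
  set U := P.biUnion T with hU
  have hsplit : ∀ p, p.1 ≤ p.2 → ∀ g ∈ T p, #(hits E n F g) =
      #{l ∈ hits E n F g | l < p.1} + m + #{l ∈ hits E n F g | p.2 < l} := by
    intro p hp g hg
    rw [← (mem_windowAuts.1 (mem_firstWindowAuts.1 hg).1).2.2, ← card_union_of_disjoint,
      ← card_union_of_disjoint]
    · congr 1
      ext l
      simp only [mem_union, mem_filter]
      have : l < p.1 ∨ (p.1 ≤ l ∧ l ≤ p.2) ∨ p.2 < l := by omega
      tauto
    · rw [disjoint_left]
      simp only [mem_union, mem_filter]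
      omega
    · rw [disjoint_left]
      simp only [mem_filter]
      omega
  have h1 : ∑ g ∈ U, #(hits E n F g) ≤ (m + 1) * #U := by
    rw [hU, sum_biUnion hdisj, card_biUnion hdisj, mul_sum]
    refine sum_le_sum fun p hp => ?_
    have hp' := hmemP.1 hp
    rw [sum_congr rfl (hsplit p hp'.1), sum_add_distrib, sum_add_distrib, sum_const, smul_eq_mul]
    have h2 := two_mul_sum_below_firstWindowAuts_le hE hr hp'.1 (by omega) hdown hbot
    have h3 := two_mul_sum_above_firstWindowAuts_le hV hE hr hp'.1 hup htop
    change 2 * ∑ g ∈ T p, _ ≤ #(T p) at h2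
    change 2 * ∑ g ∈ T p, _ ≤ #(T p) at h3
    linarith
  have h2 : ∑ g ∈ Uᶜ, #(hits E n F g) ≤ (m + 1) * #Uᶜ := by
    rw [mul_comm, ← smul_eq_mul, ← sum_const]
    refine sum_le_sum fun g hg => ?_
    by_contra hcon
    obtain ⟨i, j, hij, hj, hgij⟩ := exists_mem_firstWindowAuts (F := F) (n := n) hE hr hm (g := g)
      (by omega)
    rw [mem_compl, hU] at hg
    exact hg (mem_biUnion.2 ⟨(i, j), hmemP.2 ⟨hij, hj⟩, hgij⟩)
  have h3 := sum_add_sum_compl U fun g => #(hits E n F g)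
  have h4 := card_add_card_compl U
  have h5 : ∑ g : V ≃ₗ[K] V, #(hits E n F g) ≤ (m + 1) * Fintype.card (V ≃ₗ[K] V) := by
    rw [← h3, ← h4]
    linarith
  have h6 := card_mul_lubell (F := F) hV hr
  have h7 : (0 : ℚ) < Fintype.card (V ≃ₗ[K] V) := by exact_mod_cast Fintype.card_pos
  have h8 : ∑ g : V ≃ₗ[K] V, (#(hits E n F g) : ℚ) ≤
      (m + 1) * Fintype.card (V ≃ₗ[K] V) := by exact_mod_cast h5
  rw [← h6] at h8
  refine le_of_mul_le_mul_left ?_ h7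
  linarith

end Windows

/-! ### From the Lubell function to the `k` largest levels. -/

section TopLevels

open scoped Classical

/-- The `k` largest values of `f` on `range N` are its values on some `k`-element set. -/
lemma exists_sum_eq_sum_take_sort (f : ℕ → ℚ) {N k : ℕ} (hk : k ≤ N) :
    ∃ S ⊆ range N, #S = k ∧
      ((((Multiset.range N).map f).sort (· ≥ ·)).take k).sum = ∑ i ∈ S, f i ∧
      ∀ i ∈ S, ∀ j ∈ range N, j ∉ S → f j ≤ f i := by
  -- The indices are sorted rather than the values, which keeps equal values on different levels
  -- apart.
  set L := (List.range N).insertionSort (fun a b => f a ≥ f b) with hL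
  have hperm : L.Perm (List.range N) := List.perm_insertionSort _ _
  have hsorted : L.Pairwise (fun a b => f a ≥ f b) := by
    have : Std.Total (fun a b : ℕ => f a ≥ f b) := ⟨fun a b => le_total _ _⟩
    have : IsTrans ℕ (fun a b : ℕ => f a ≥ f b) := ⟨fun a b c h h' => le_trans h' h⟩
    exact List.pairwise_insertionSort _ _
  have hnodup : L.Nodup := hperm.nodup_iff.2 List.nodup_range
  have hsort : ((Multiset.range N).map f).sort (· ≥ ·) = L.map f := by
    refine List.Perm.eq_of_pairwise' (r := (· ≥ ·)) (Multiset.pairwise_sort _ _)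
      (List.pairwise_map.2 hsorted) ?_
    rw [← Multiset.coe_eq_coe, Multiset.sort_eq, ← Multiset.map_coe, Multiset.coe_eq_coe.2 hperm]
    rfl
  have hlen : L.length = N := by rw [hperm.length_eq, List.length_range]
  have hmem : ∀ j, j ∈ L ↔ j < N := fun j => by rw [hperm.mem_iff, List.mem_range]
  have htake : (L.take k).Nodup := hnodup.sublist (List.take_sublist _ _)
  refine ⟨(L.take k).toFinset, ?_, ?_, ?_, ?_⟩
  · intro i hi
    rw [mem_range, ← hmem]
    exact List.mem_of_mem_take (List.mem_toFinset.1 hi)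
  · rw [List.toFinset_card_of_nodup htake, List.length_take, hlen, min_eq_left hk]
  · rw [hsort, ← List.map_take, List.sum_toFinset _ htake]
  · intro i hi j hj hjS
    rw [List.mem_toFinset] at hi hjS
    rw [mem_range, ← hmem, ← List.take_append_drop k L, List.mem_append] at hj
    rw [← List.take_append_drop k L, List.pairwise_append] at hsorted
    exact hsorted.2.2 i hi j (hj.resolve_left hjS)

variable {K V : Type*} [Field K] [AddCommGroup V] [Module K V] [FiniteDimensional K V]
  [Fintype K] [Fintype (Submodule K V)] {q n k : ℕ}

lemma exists_top_levels (hq : Fintype.card K = q) (hV : finrank K V = n) (hk : k ≤ n + 1) :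
    ∃ S ⊆ range (n + 1), #S = k ∧ qSigma q n k = ∑ i ∈ S, (levelCard K V i : ℚ) ∧
      ∀ i ∈ S, ∀ j ∈ range (n + 1), j ∉ S → levelCard K V j ≤ levelCard K V i := by
  obtain ⟨S, hS, hSk, hsum, htop⟩ := exists_sum_eq_sum_take_sort (qBinom q n) hk
  have hl : ∀ i ∈ range (n + 1), (levelCard K V i : ℚ) = qBinom q n i := fun i hi =>
    levelCard_eq_qBinom hq hV (by rw [mem_range] at hi; omega)
  refine ⟨S, hS, hSk, ?_, fun i hi j hj hjS => ?_⟩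
  · rw [qSigma, hsum]
    exact sum_congr rfl fun i hi => (hl i (hS hi)).symm
  · have := htop i hi j hj hjS
    rw [← hl i (hS hi), ← hl j hj] at this
    exact_mod_cast this

/-- Bounding the size of a family by its Lubell function, for a threshold `c` which separates the
sizes of the levels in `S` from the others. -/
lemma card_le_sum_add_mul_lubell (hV : finrank K V = n) (F : Finset (Submodule K V)) {S : Finset ℕ}
    (hS : S ⊆ range (n + 1)) {c : ℚ} (hc : ∀ i ∈ S, c ≤ levelCard K V i)
    (hc' : ∀ j ∈ range (n + 1), j ∉ S → (levelCard K V j : ℚ) ≤ c) :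
    (#F : ℚ) ≤ ∑ i ∈ S, (levelCard K V i : ℚ) + c * (lubell F - #S) := by
  have hmaps : ∀ x ∈ F, finrank K x ∈ range (n + 1) := fun x _ => by
    have := Submodule.finrank_le x
    rw [mem_range]
    omega
  set a : ℕ → ℕ := fun i => #(F.filter fun x : Submodule K V => finrank K x = i) with ha
  have h1 : (#F : ℚ) = ∑ i ∈ range (n + 1), (a i : ℚ) := by
    rw [card_eq_sum_card_fiberwise hmaps]
    push_cast
    rfl
  have h2 : lubell F = ∑ i ∈ range (n + 1), (a i : ℚ) * (levelCard K V i : ℚ)⁻¹ := by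
    rw [lubell, ← sum_fiberwise_of_maps_to hmaps]
    refine sum_congr rfl fun i _ => ?_
    rw [sum_congr rfl fun x hx => by rw [(mem_filter.1 hx).2], sum_const, nsmul_eq_mul]
  have h3 : ∑ i ∈ S, (levelCard K V i : ℚ) =
      ∑ i ∈ range (n + 1), if i ∈ S then (levelCard K V i : ℚ) else 0 := by
    rw [sum_ite_mem, inter_eq_right.2 hS]
  have h4 : (#S : ℚ) = ∑ i ∈ range (n + 1), if i ∈ S then (1 : ℚ) else 0 := by
    rw [sum_ite_mem, inter_eq_right.2 hS]
    simp
  rw [h1, h2, h3, h4, ← sum_sub_distrib, mul_sum, ← sum_add_distrib]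
  refine sum_le_sum fun i hi => ?_
  have hpos : (0 : ℚ) < levelCard K V i := by
    exact_mod_cast levelCard_pos hV (by rw [mem_range] at hi; omega)
  have hle : (a i : ℚ) ≤ levelCard K V i := by
    have : a i ≤ levelCard K V i := by
      refine card_le_card fun x hx => ?_
      exact mem_filter.2 ⟨mem_univ _, (mem_filter.1 hx).2⟩
    exact_mod_cast this
  -- With `t` the occupied proportion and `N` the size of the level, the claim is `(1 - t) (N - c) ≥
  -- 0` on `S` and `t (c - N) ≥ 0` off `S`.
  obtain ⟨t, ht⟩ : ∃ t : ℚ, t = (a i : ℚ) * (levelCard K V i : ℚ)⁻¹ := ⟨_, rfl⟩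
  have hat : (a i : ℚ) = t * levelCard K V i := by
    rw [ht, inv_mul_cancel_right₀ hpos.ne']
  have ht0 : 0 ≤ t := by
    rw [ht]
    exact mul_nonneg (Nat.cast_nonneg _) (inv_nonneg.2 hpos.le)
  have ht1 : t ≤ 1 := by
    rw [hat] at hle
    by_contra hcon
    nlinarith
  rw [← ht, hat]
  split_ifs with h
  · have := hc i h
    nlinarith
  · have := hc' i hi h
    nlinarith

/-- The smallest of the `k` largest levels can serve as a threshold. -/
lemma exists_threshold (hq : Fintype.card K = q) (hV : finrank K V = n) (hk : 1 ≤ k)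
    (hn : k + 1 ≤ n) :
    ∃ c : ℚ, 0 ≤ c ∧ (3 ≤ n → 4 ≤ c) ∧
      (∀ F : Finset (Submodule K V), (#F : ℚ) ≤ qSigma q n k + c * (lubell F - k)) ∧
      (k = 1 → qSigma q n k = c ∧ (n + 1 : ℚ) ≤ c) := by
  have hq2 : 2 ≤ q := hq ▸ Fintype.one_lt_card
  obtain ⟨S, hS, hSk, hsum, htop⟩ := exists_top_levels (V := V) hq hV (k := k) (by omega)
  obtain ⟨i₀, hi₀, hmin⟩ := exists_min_image S (levelCard K V) (card_pos.1 (by omega))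
  have hint : ∀ i, 0 < i → i < n → 2 * (n - 1) ≤ levelCard K V i := by
    intro i hi hin
    have := two_mul_le_card_level hq (u := (⊥ : Submodule K V)) (v := ⊤) bot_le (l := i)
      (by simpa using hi) (by rw [finrank_top]; omega)
    rw [finrank_bot, finrank_top, hV, Nat.sub_zero] at this
    simpa [levelCard] using this
  have hlarge : 2 * (n - 1) ≤ levelCard K V i₀ := by
    by_cases h : 0 < i₀ ∧ i₀ < n
    · exact hint i₀ h.1 h.2
    -- If `i₀` is `0` or `n`, the remaining `k - 1` elements of `S` cannot cover all `n - 1 ≥ k`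
    -- inner levels, and a missed inner level is no larger than level `i₀`.
    obtain ⟨j, hj, hjS⟩ : ∃ j ∈ Ioo 0 n, j ∉ S := by
      by_contra! hcon
      have h1 : insert i₀ (Ioo 0 n) ⊆ S := insert_subset hi₀ hcon
      have h2 := card_le_card h1
      rw [card_insert_of_notMem (by simpa using h), Nat.card_Ioo] at h2
      omega
    rw [mem_Ioo] at hj
    exact (hint j hj.1 hj.2).trans (htop i₀ hi₀ j (mem_range.2 (by omega)) hjS)
  refine ⟨levelCard K V i₀, by positivity, fun h3 => ?_, fun F => ?_, fun h1 => ?_⟩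
  · have : 4 ≤ levelCard K V i₀ := by omega
    exact_mod_cast this
  · rw [hsum, ← hSk]
    refine card_le_sum_add_mul_lubell hV F hS (fun i hi => ?_) fun j hj hjS => ?_
    · exact_mod_cast hmin i hi
    · exact_mod_cast htop i₀ hi₀ j hj hjS
  · subst h1
    obtain ⟨i, rfl⟩ := card_eq_one.1 hSk
    rw [mem_singleton] at hi₀
    subst hi₀
    refine ⟨by rw [hsum, sum_singleton], ?_⟩
    have h1 : levelCard K V 1 = qInt q n := by
      rw [← card_covers_bot hq (u := (⊥ : Submodule K V)) (v := ⊤) bot_le (d := n)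
        (by simp [hV])]
      simp [levelCard]
    have h2 : levelCard K V 1 ≤ levelCard K V i₀ := by
      by_cases h : i₀ = 1
      · rw [h]
      · exact htop i₀ (mem_singleton_self _) 1 (mem_range.2 (by omega)) (by simpa using Ne.symm h)
    have h3 := two_pow_le_qInt hq2 n
    have h4 : ∀ m, 2 ≤ m → m + 2 ≤ 2 ^ m := by
      intro m hm
      induction m, hm using Nat.le_induction with
      | base => norm_num
      | succ m hm ih => rw [pow_succ]; omega
    have h5 := h4 n (by omega)
    have h6 : n + 1 ≤ levelCard K V i₀ := by omega
    exact_mod_cast h6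

end TopLevels

/-! ### Duality, and the upper bound for `k ≥ 2`. -/

section UpperBound

open scoped Classical

lemma exists_preimage_chain {α β : Type*} [PartialOrder α] [PartialOrder β] {δ : α → β}
    (hδ : ∀ a b, δ a ≤ δ b ↔ b ≤ a) {F : Finset α} {s : Finset β} (hs : s ⊆ F.image δ)
    (hc : IsChain (· ≤ ·) (s : Set β)) :
    ∃ t ⊆ F, IsChain (· ≤ ·) (t : Set α) ∧ #t = #s ∧ ∀ x ∈ t, δ x ∈ s := by
  have hinj : Function.Injective δ := fun a b h =>
    le_antisymm ((hδ _ _).1 h.ge) ((hδ _ _).1 h.le)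
  have himg : (F.filter fun x => δ x ∈ s).image δ = s := by
    ext y
    simp only [mem_image, mem_filter]
    constructor
    · rintro ⟨x, ⟨-, hx⟩, rfl⟩
      exact hx
    · intro hy
      obtain ⟨x, hx, rfl⟩ := mem_image.1 (hs hy)
      exact ⟨x, ⟨hx, hy⟩, rfl⟩
  refine ⟨F.filter fun x => δ x ∈ s, filter_subset _ _, ?_, ?_, fun x hx => (mem_filter.1 hx).2⟩
  · intro x hx y hy hxy
    rw [mem_coe, mem_filter] at hx hy
    exact (hc hx.2 hy.2 (hinj.ne hxy)).symm.imp (hδ _ _).1 (hδ _ _).1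
  · rw [← card_image_of_injective _ hinj, himg]

lemma lt_iff_of_anti {α β : Type*} [PartialOrder α] [PartialOrder β] {δ : α → β}
    (hδ : ∀ a b, δ a ≤ δ b ↔ b ≤ a) {a b : α} : δ a < δ b ↔ b < a := by
  rw [lt_iff_le_not_ge, lt_iff_le_not_ge, hδ, hδ]

lemma DownFree.image_anti {α β : Type*} [PartialOrder α] [PartialOrder β] {δ : α → β}
    (hδ : ∀ a b, δ a ≤ δ b ↔ b ≤ a) {k : ℕ} {F : Finset α} (hF : DownFree k F) :
    UpFree k (F.image δ) := by
  intro s hs hc hk y hy z hz hsy hsz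
  obtain ⟨t, htF, htc, htk, hts⟩ := exists_preimage_chain hδ hs hc
  obtain ⟨y, hyF, rfl⟩ := mem_image.1 hy
  obtain ⟨z, hzF, rfl⟩ := mem_image.1 hz
  rw [hδ, hδ]
  exact (hF t htF htc (htk.trans hk) y hyF z hzF
    (fun x hx => (lt_iff_of_anti hδ).1 (hsy _ (hts x hx)))
    fun x hx => (lt_iff_of_anti hδ).1 (hsz _ (hts x hx))).symm

lemma UpFree.image_anti {α β : Type*} [PartialOrder α] [PartialOrder β] {δ : α → β}
    (hδ : ∀ a b, δ a ≤ δ b ↔ b ≤ a) {k : ℕ} {F : Finset α} (hF : UpFree k F) :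
    DownFree k (F.image δ) := by
  intro s hs hc hk y hy z hz hsy hsz
  obtain ⟨t, htF, htc, htk, hts⟩ := exists_preimage_chain hδ hs hc
  obtain ⟨y, hyF, rfl⟩ := mem_image.1 hy
  obtain ⟨z, hzF, rfl⟩ := mem_image.1 hz
  rw [hδ, hδ]
  exact (hF t htF htc (htk.trans hk) y hyF z hzF
    (fun x hx => (lt_iff_of_anti hδ).1 (hsy _ (hts x hx)))
    fun x hx => (lt_iff_of_anti hδ).1 (hsz _ (hts x hx))).symm

variable {K V : Type*} [Field K] [AddCommGroup V] [Module K V] [FiniteDimensional K V]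

lemma dualAnnihilator_le_iff (A B : Submodule K V) :
    A.dualAnnihilator ≤ B.dualAnnihilator ↔ B ≤ A :=
  Subspace.dualAnnihilator_le_dualAnnihilator_iff

lemma dualAnnihilator_injective :
    Function.Injective (Submodule.dualAnnihilator : Submodule K V → Submodule K (Dual K V)) :=
  fun _ _ h => Subspace.dualAnnihilator_inj.1 h

variable [Fintype K] {q n k : ℕ}

variable (K V) in
lemma finite_submodule_and_equiv : Finite (Submodule K V) ∧ Finite (V ≃ₗ[K] V) := by
  have : Finite V := Module.finite_of_finite K
  exact ⟨inferInstance, Finite.of_injective (fun e => (e : V → V)) DFunLike.coe_injective⟩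

/-- With `⊥` available as the bottom of every chain, the rest of `F` is `UpFree (k - 1)`, and its
Lubell function falls `1/2` short of `k`. As `c ≥ 4`, this saves `c / 2 ≥ 2`, the number of members
that may have been deleted. -/
lemma card_le_qSigma_of_bot_mem (hq : Fintype.card K = q) (hV : finrank K V = n) (hk : 2 ≤ k)
    (hn : k + 1 ≤ n) {F : Finset (Submodule K V)} (hF : UpFree k F) (hbot : ⊥ ∈ F) :
    (#F : ℚ) ≤ qSigma q n k := by
  obtain ⟨h1, h2⟩ := finite_submodule_and_equiv K V
  have := Fintype.ofFinite (Submodule K V)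
  have := Fintype.ofFinite (V ≃ₗ[K] V)
  obtain ⟨m, rfl⟩ : ∃ m, k = m + 1 := ⟨k - 1, by omega⟩
  obtain ⟨c, -, hc, hcF, -⟩ := exists_threshold (V := V) hq hV (k := m + 1) (by omega) hn
  have hc4 := hc (by omega)
  set F' := (F.erase ⊥).erase ⊤ with hF'
  have hsub : F' ⊆ F := (erase_subset _ _).trans (erase_subset _ _)
  have hne : ∀ x ∈ F', ⊥ < x := fun x hx => by
    rw [hF', mem_erase, mem_erase] at hx
    exact bot_lt_iff_ne_bot.2 hx.2.1
  have hup : UpFree m F' := by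
    intro s hs hc hsm y hy z hz hsy hsz
    have hbs : ⊥ ∉ s := fun h => lt_irrefl _ (hne _ (hs h))
    refine hF (insert ⊥ s) (insert_subset hbot (hs.trans hsub)) ?_ ?_ y (hsub hy) z (hsub hz) ?_ ?_
    · rw [coe_insert]
      exact hc.insert fun w _ _ => Or.inl bot_le
    · rw [card_insert_of_notMem hbs, hsm]
    · intro x hx
      rcases mem_insert.1 hx with rfl | hx
      exacts [hne y hy, hsy x hx]
    · intro x hx
      rcases mem_insert.1 hx with rfl | hx
      exacts [hne z hz, hsz x hx]
  have hlub := lubell_le_of_upFree hV (by omega) hup (by simp [hF'])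
  have h3 := hcF F'
  have h4 : #F ≤ #F' + 2 := by
    have h5 : #(F.erase ⊥) + 1 = #F := card_erase_add_one hbot
    have h6 : #(F.erase ⊥) - 1 ≤ #F' := pred_card_le_card_erase
    omega
  have h5 : (#F : ℚ) ≤ #F' + 2 := by exact_mod_cast h4
  push_cast at h3
  nlinarith

lemma card_le_qSigma_of_two_le (hq : Fintype.card K = q) (hV : finrank K V = n) (hk : 2 ≤ k)
    (hn : k + 1 ≤ n) {F : Finset (Submodule K V)} (hup : UpFree k F) (hdown : DownFree k F) :
    (#F : ℚ) ≤ qSigma q n k := by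
  by_cases hbot : ⊥ ∈ F
  · exact card_le_qSigma_of_bot_mem hq hV hk hn hup hbot
  by_cases htop : ⊤ ∈ F
  · rw [← card_image_of_injective F (dualAnnihilator_injective (K := K) (V := V))]
    refine card_le_qSigma_of_bot_mem hq (Subspace.dual_finrank_eq.trans hV) hk hn
      (hdown.image_anti dualAnnihilator_le_iff) (mem_image.2 ⟨⊤, htop, ?_⟩)
    exact Submodule.dualAnnihilator_top
  obtain ⟨h1, h2⟩ := finite_submodule_and_equiv K V
  have := Fintype.ofFinite (Submodule K V)
  have := Fintype.ofFinite (V ≃ₗ[K] V)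
  obtain ⟨m, rfl⟩ : ∃ m, k = m + 1 := ⟨k - 1, by omega⟩
  obtain ⟨c, hc0, -, hcF, -⟩ := exists_threshold (V := V) hq hV (k := m + 1) (by omega) hn
  have hlub := lubell_le_of_upFree_of_downFree hV (by omega) hup hdown hbot htop
  have h3 := hcF F
  push_cast at h3
  nlinarith

end UpperBound

/-! ### An extremal bound in projective planes. -/

section Plane

open scoped Classical

/-- If all lines through some point `z ∉ P` are in `L`, joining `z` to the points of `P` gives
distinct lines, hence `#P ≤ q + 1`. Otherwise each point outside `P` is on at most `q` lines of `L`,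
while each line of `L` has at least `q` points outside `P`; double counting gives `#L ≤ Q - #P`. -/
lemma plane_alternative {α β : Type*} {r : α → β → Prop} {Pt P : Finset α} {Ln L : Finset β}
    {q Q : ℕ} (hq : 1 ≤ q) (hPt : #Pt = Q) (hline : ∀ l ∈ Ln, #{p ∈ Pt | r p l} = q + 1)
    (hpoint : ∀ p ∈ Pt, #{l ∈ Ln | r p l} = q + 1)
    (hjoin : ∀ p ∈ Pt, ∀ p' ∈ Pt, ∃ l ∈ Ln, r p l ∧ r p' l) (hP : P ⊆ Pt) (hL : L ⊆ Ln)
    (hPL : ∀ l ∈ L, ∀ p ∈ P, ∀ p' ∈ P, r p l → r p' l → p = p') :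
    #P ≤ q + 1 ∨ #P + #L ≤ Q := by
  by_cases h : ∃ z ∈ Pt, z ∉ P ∧ ∀ l ∈ Ln, r z l → l ∈ L
  · obtain ⟨z, hz, -, hzL⟩ := h
    left
    rw [← hpoint z hz]
    have : Nonempty β := ⟨(hjoin z hz z hz).choose⟩
    choose! f hfL hfz hfp using fun p (hp : p ∈ Pt) => hjoin z hz p hp
    refine card_le_card_of_injOn f (fun p hp => ?_) fun p hp p' hp' hpp => ?_
    · exact mem_filter.2 ⟨hfL p (hP hp), hfz p (hP hp)⟩
    · refine hPL (f p) (hzL _ (hfL p (hP hp)) (hfz p (hP hp))) p hp p' hp' (hfp p (hP hp)) ?_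
      rw [hpp]
      exact hfp p' (hP hp')
  · right
    push Not at h
    have h1 : #L * q ≤ #(Pt \ P) * q := by
      refine card_mul_le_card_mul (fun l p => r p l) (fun l hl => ?_) fun p hp => ?_
      · have h2 : #(P.filter fun p => r p l) ≤ 1 := card_le_one.2 fun p hp p' hp' => by
          rw [mem_filter] at hp hp'
          exact hPL l hl p hp.1 p' hp'.1 hp.2 hp'.2
        have h3 : (Pt.filter fun p => r p l) ⊆
            bipartiteAbove (fun l p => r p l) (Pt \ P) l ∪ P.filter fun p => r p l := by
          intro p hp
          simp only [mem_union, mem_filter, bipartiteAbove, mem_sdiff] at hp ⊢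
          tauto
        have h4 := (card_le_card h3).trans (card_union_le _ _)
        rw [hline l (hL hl)] at h4
        omega
      · rw [mem_sdiff] at hp
        obtain ⟨l, hl, hpl, hlL⟩ := h p hp.1 hp.2
        rw [← Nat.lt_succ_iff, Nat.succ_eq_add_one, ← hpoint p hp.1]
        refine card_lt_card ((ssubset_iff_of_subset ?_).2 ⟨l, ?_, ?_⟩)
        · exact filter_subset_filter _ hL
        · exact mem_filter.2 ⟨hl, hpl⟩
        · simp [bipartiteBelow, hlL]
    have h2 := Nat.le_of_mul_le_mul_right h1 (by omega)
    rw [card_sdiff_of_subset hP, hPt] at h2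
    have h3 := card_le_card hP
    omega

/-- In a projective plane, a set of points and a set of lines such that every chosen line carries
at most one chosen point and every chosen point is on at most one chosen line have together at most
as many elements as there are points. -/
lemma plane_bound {α β : Type*} {r : α → β → Prop} {Pt P : Finset α} {Ln L : Finset β}
    {q Q : ℕ} (hq : 1 ≤ q) (hQ : 2 * (q + 1) ≤ Q) (hPt : #Pt = Q) (hLn : #Ln = Q)
    (hline : ∀ l ∈ Ln, #{p ∈ Pt | r p l} = q + 1)
    (hpoint : ∀ p ∈ Pt, #{l ∈ Ln | r p l} = q + 1)
    (hjoin : ∀ p ∈ Pt, ∀ p' ∈ Pt, ∃ l ∈ Ln, r p l ∧ r p' l)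
    (hmeet : ∀ l ∈ Ln, ∀ l' ∈ Ln, ∃ p ∈ Pt, r p l ∧ r p l') (hP : P ⊆ Pt) (hL : L ⊆ Ln)
    (hPL : ∀ l ∈ L, ∀ p ∈ P, ∀ p' ∈ P, r p l → r p' l → p = p')
    (hLP : ∀ p ∈ P, ∀ l ∈ L, ∀ l' ∈ L, r p l → r p l' → l = l') :
    #P + #L ≤ Q := by
  rcases plane_alternative hq hPt hline hpoint hjoin hP hL hPL with h1 | h1
  · rcases plane_alternative (r := fun l p => r p l) hq hLn hpoint hline hmeet hL hP hLP with
      h2 | h2 <;> omega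
  · exact h1

end Plane

/-! ### The case `k = 1` on the middle levels. -/

section TwoLevels

open scoped Classical

lemma UpFree.comparable {α : Type*} [PartialOrder α] {F : Finset α} (h : UpFree 1 F) {x y z : α}
    (hx : x ∈ F) (hy : y ∈ F) (hz : z ∈ F) (hxy : x < y) (hxz : x < z) : y ≤ z ∨ z ≤ y :=
  h {x} (by simpa using hx) (by simp) (by simp) y hy z hz (by simpa using hxy) (by simpa using hxz)

lemma DownFree.comparable {α : Type*} [PartialOrder α] {F : Finset α} (h : DownFree 1 F)
    {x y z : α} (hx : x ∈ F) (hy : y ∈ F) (hz : z ∈ F) (hxy : y < x) (hxz : z < x) :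
    y ≤ z ∨ z ≤ y :=
  h {x} (by simpa using hx) (by simp) (by simp) y hy z hz (by simpa using hxy) (by simpa using hxz)

lemma upFree_one_of_forall {α : Type*} [PartialOrder α] {F : Finset α}
    (h : ∀ x ∈ F, ∀ y ∈ F, ∀ z ∈ F, x < y → x < z → y ≤ z ∨ z ≤ y) : UpFree 1 F := by
  intro s hs _ hs1 y hy z hz hsy hsz
  obtain ⟨x, rfl⟩ := card_eq_one.1 hs1
  rw [singleton_subset_iff] at hs
  exact h x hs y hy z hz (hsy x (mem_singleton_self x)) (hsz x (mem_singleton_self x))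

lemma downFree_one_of_forall {α : Type*} [PartialOrder α] {F : Finset α}
    (h : ∀ x ∈ F, ∀ y ∈ F, ∀ z ∈ F, y < x → z < x → y ≤ z ∨ z ≤ y) : DownFree 1 F := by
  intro s hs _ hs1 y hy z hz hsy hsz
  obtain ⟨x, rfl⟩ := card_eq_one.1 hs1
  rw [singleton_subset_iff] at hs
  exact h x hs y hy z hz (hsy x (mem_singleton_self x)) (hsz x (mem_singleton_self x))

variable {K V : Type*} [Field K] [AddCommGroup V] [Module K V] [FiniteDimensional K V]
  [Fintype K] [Fintype (Submodule K V)] {q n : ℕ} {F : Finset (Submodule K V)}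

lemma lt_of_le_of_finrank_lt {x y : Submodule K V} (h : x ≤ y)
    (h' : finrank K x < finrank K y) : x < y :=
  lt_of_le_of_ne h (by rintro rfl; omega)

lemma card_interval_le (hq : Fintype.card K = q) {u v : Submodule K V} (huv : u ≤ v)
    (hd : finrank K u + 3 = finrank K v) (hup : UpFree 1 F) (hdown : DownFree 1 F) :
    #(F.filter fun x : Submodule K V => u ≤ x ∧ x ≤ v ∧ finrank K x = finrank K u + 1) +
      #(F.filter fun x : Submodule K V => u ≤ x ∧ x ≤ v ∧ finrank K x + 1 = finrank K v) ≤
        qInt q 3 := by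
  have hq2 : 2 ≤ q := hq ▸ Fintype.one_lt_card
  have hq3 : qInt q 3 = q ^ 2 + q + 1 := by simp [qInt, sum_range_succ]; ring
  have hq' : qInt q 2 = q + 1 := by simp [qInt, sum_range_succ]; ring
  refine plane_bound (q := q) (r := fun p l : Submodule K V => p ≤ l)
    (Pt := ({x | u ≤ x ∧ x ≤ v ∧ finrank K x = finrank K u + 1} : Finset (Submodule K V)))
    (Ln := ({x | u ≤ x ∧ x ≤ v ∧ finrank K x + 1 = finrank K v} : Finset (Submodule K V)))
    (by omega) (by rw [hq3]; nlinarith) (card_covers_bot hq huv hd) (card_covers_top hq huv hd)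
    ?_ ?_ ?_ ?_ (filter_subset_filter _ (subset_univ _)) (filter_subset_filter _ (subset_univ _))
    ?_ ?_
  · intro l hl
    simp only [mem_filter, mem_univ, true_and] at hl
    rw [← hq', ← card_covers_bot hq hl.1 (d := 2) (by omega), filter_filter]
    congr 1
    ext x
    simp only [mem_filter, mem_univ, true_and]
    have : x ≤ l → x ≤ v := fun h => h.trans hl.2.1
    tauto
  · intro p hp
    simp only [mem_filter, mem_univ, true_and] at hp
    rw [← hq', ← card_covers_top hq hp.2.1 (d := 2) (by omega), filter_filter]
    congr 1
    ext x
    simp only [mem_filter, mem_univ, true_and]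
    have : p ≤ x → u ≤ x := fun h => hp.1.trans h
    tauto
  · intro p hp p' hp'
    simp only [mem_filter, mem_univ, true_and] at hp hp'
    have h1 := Submodule.finrank_sup_add_finrank_inf_eq p p'
    have h2 := Submodule.finrank_mono (le_inf hp.1 hp'.1)
    -- The two points may coincide, so the line is some `w` above `p ⊔ p'`, not the join itself.
    obtain ⟨w, hw, hwv, hwd⟩ := exists_finrank_eq_between (sup_le hp.2.1 hp'.2.1)
      (l := finrank K u + 2) (by omega) (by omega)
    refine ⟨w, ?_, le_sup_left.trans hw, le_sup_right.trans hw⟩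
    simp only [mem_filter, mem_univ, true_and]
    exact ⟨hp.1.trans (le_sup_left.trans hw), hwv, by omega⟩
  · intro l hl l' hl'
    simp only [mem_filter, mem_univ, true_and] at hl hl'
    have h1 := Submodule.finrank_sup_add_finrank_inf_eq l l'
    have h2 := Submodule.finrank_mono (sup_le hl.2.1 hl'.2.1)
    obtain ⟨w, huw, hw, hwd⟩ := exists_finrank_eq_between (le_inf hl.1 hl'.1)
      (l := finrank K u + 1) (by omega) (by omega)
    refine ⟨w, ?_, hw.trans inf_le_left, hw.trans inf_le_right⟩
    simp only [mem_filter, mem_univ, true_and]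
    exact ⟨huw, hw.trans (inf_le_left.trans hl.2.1), by omega⟩
  · intro l hl p hp p' hp' h h'
    rw [mem_filter] at hl hp hp'
    exact eq_of_comparable_of_finrank_eq (hdown.comparable hl.1 hp.1 hp'.1
      (lt_of_le_of_finrank_lt h (by omega)) (lt_of_le_of_finrank_lt h' (by omega))) (by omega)
  · intro p hp l hl l' hl' h h'
    rw [mem_filter] at hl hp hl'
    exact eq_of_comparable_of_finrank_eq (hup.comparable hp.1 hl.1 hl'.1
      (lt_of_le_of_finrank_lt h (by omega)) (lt_of_le_of_finrank_lt h' (by omega))) (by omega)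

/-- The bound for a family living on the two middle levels of an odd-dimensional space. -/
lemma lubell_le_one_of_two_levels [Fintype (V ≃ₗ[K] V)] (hq : Fintype.card K = q) {m : ℕ}
    (hm : 1 ≤ m) (hV : finrank K V = 2 * m + 1) (hup : UpFree 1 F) (hdown : DownFree 1 F)
    (hF : ∀ x ∈ F, finrank K x = m ∨ finrank K x = m + 1) : lubell F ≤ 1 := by
  obtain ⟨E, hE, hr⟩ := exists_flag hV
  have hQ : 0 < qInt q 3 := by simp [qInt, sum_range_succ]
  set G := Fintype.card (V ≃ₗ[K] V) with hG
  have hG0 : 0 < G := Fintype.card_pos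
  -- The random interval from level `m - 1` to level `m + 2` of the flag is a projective plane whose
  -- points and lines lie on the two middle levels. Both levels contribute `qInt q 3` subspaces to
  -- it, so `G * qInt q 3 * lubell F` counts the incidences with `F`.
  obtain ⟨P, hP⟩ : ∃ P : (V ≃ₗ[K] V) → Submodule K V → Prop, ∀ g x, P g x ↔
    flagAt E g (m - 1) ≤ x ∧ x ≤ flagAt E g (m + 2) := ⟨_, fun _ _ => Iff.rfl⟩
  have hlow : ∀ g, finrank K (flagAt E g (m - 1)) = m - 1 := fun g =>
    finrank_flagAt hr g (by omega)
  have hhigh : ∀ g, finrank K (flagAt E g (m + 2)) = m + 2 := fun g =>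
    finrank_flagAt hr g (by omega)
  have hle : ∀ g, flagAt E g (m - 1) ≤ flagAt E g (m + 2) := fun g =>
    flagAt_mono hE g (by omega)
  have hinv : ∀ g₀ g x, P g x → P (g₀ * g) (x.map (g₀ : V →ₗ[K] V)) := fun g₀ g x h => by
    rw [hP] at h
    simp only [hP, flagAt_mul]
    exact ⟨Submodule.map_mono h.1, Submodule.map_mono h.2⟩
  have hcount : ∀ x ∈ F, #{g | P g x} * levelCard K V (finrank K x) = G * qInt q 3 := by
    intro x hx
    refine (card_mul_levelCard hinv rfl).trans ?_
    rw [hG, ← card_univ, ← smul_eq_mul, ← sum_const]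
    refine sum_congr rfl fun g _ => ?_
    have h1 := hlow g
    have h2 := hhigh g
    rcases hF x hx with h | h
    · rw [← card_covers_bot hq (hle g) (d := 3) (by omega)]
      congr 1
      ext y
      simp only [hP, mem_filter, mem_univ, true_and]
      have : finrank K y = finrank K x ↔
        finrank K y = finrank K (flagAt E g (m - 1)) + 1 := by omega
      tauto
    · rw [← card_covers_top hq (hle g) (d := 3) (by omega)]
      congr 1
      ext y
      simp only [hP, mem_filter, mem_univ, true_and]
      have : finrank K y = finrank K x ↔
        finrank K y + 1 = finrank K (flagAt E g (m + 2)) := by omega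
      tauto
  have hbound : ∀ g, #(F.filter fun x => P g x) ≤ qInt q 3 := by
    intro g
    have h1 := hlow g
    have h2 := hhigh g
    refine le_trans ?_ (card_interval_le hq (hle g) (by omega) hup hdown)
    refine (card_le_card ?_).trans (card_union_le _ _)
    intro x hx
    rw [mem_filter, hP] at hx
    rw [mem_union, mem_filter, mem_filter]
    rcases hF x hx.1 with h | h
    · exact Or.inl ⟨hx.1, hx.2.1, hx.2.2, by omega⟩
    · exact Or.inr ⟨hx.1, hx.2.1, hx.2.2, by omega⟩
  have hswap := sum_card_bipartiteAbove_eq_sum_card_bipartiteBelow P (s := univ) (t := F)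
  simp only [bipartiteAbove, bipartiteBelow] at hswap
  have h1 : ∑ x ∈ F, #{g | P g x} ≤ G * qInt q 3 := by
    rw [← hswap, hG, ← card_univ, ← smul_eq_mul, ← sum_const]
    exact sum_le_sum fun g _ => hbound g
  have h2 : (G * qInt q 3 : ℚ) * lubell F = ∑ x ∈ F, (#{g | P g x} : ℚ) := by
    rw [lubell, mul_sum]
    refine sum_congr rfl fun x hx => ?_
    have h3 := levelCard_pos hV (hV ▸ Submodule.finrank_le x)
    have h4 : (G * qInt q 3 : ℚ) = #{g | P g x} * levelCard K V (finrank K x) := by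
      exact_mod_cast (hcount x hx).symm
    rw [h4, mul_inv_cancel_right₀]
    exact_mod_cast h3.ne'
  have h3 : (0 : ℚ) < G * qInt q 3 := by exact_mod_cast Nat.mul_pos hG0 hQ
  refine le_of_mul_le_mul_left ?_ h3
  rw [h2, mul_one]
  exact_mod_cast h1

lemma lubell_le_one_of_level (hV : finrank K V = n) {m : ℕ} (hm : m ≤ n)
    (hF : ∀ x ∈ F, finrank K x = m) : lubell F ≤ 1 := by
  have h1 : #F ≤ levelCard K V m := card_le_card fun x hx => mem_filter.2 ⟨mem_univ _, hF x hx⟩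
  have h2 : (0 : ℚ) < levelCard K V m := by exact_mod_cast levelCard_pos hV hm
  rw [lubell, sum_congr rfl fun x hx => by rw [hF x hx], sum_const, nsmul_eq_mul]
  rw [mul_inv_le_iff₀ h2, one_mul]
  exact_mod_cast h1

end TwoLevels

/-! ### Pushing a family towards the middle for `k = 1`. -/

section Push

open scoped Classical

variable {K V : Type*} [Field K] [AddCommGroup V] [Module K V] [FiniteDimensional K V]
  [Fintype K] [Fintype (Submodule K V)] {q n : ℕ} {F : Finset (Submodule K V)}

/-- A member of the top level covers many subspaces which contain no member of the family. -/
lemma pow_le_card_covered (hq : Fintype.card K = q) (hdown : DownFree 1 F) {b : ℕ} (hb : 1 ≤ b)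
    (hF : ∀ x ∈ F, 1 ≤ finrank K x) {y : Submodule K V} (hy : y ∈ F) (hyb : finrank K y = b) :
    q ^ (b - 1) ≤
      #{w : Submodule K V | finrank K w + 1 = b ∧ (∀ x ∈ F, ¬ x ≤ w) ∧ w ≤ y} := by
  obtain ⟨a, rfl⟩ : ∃ a, b = a + 1 := ⟨b - 1, by omega⟩
  have hall := card_covers_top hq (u := (⊥ : Submodule K V)) (v := y) bot_le (d := a + 1)
    (by simp [hyb])
  rw [qInt_succ] at hall
  -- By `DownFree 1` the members strictly below `y` form a chain, so every bad hyperplane of `y`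
  -- contains its least member `d`. As `dim d ≥ 1`, at most `qInt q a` of the `qInt q (a + 1)`
  -- hyperplanes are bad, leaving `q ^ a`.
  have hbad : #{w : Submodule K V | w ≤ y ∧ finrank K w = a ∧ ∃ x ∈ F, x ≤ w} ≤ qInt q a := by
    by_cases hne : (F.filter fun x => x < y).Nonempty
    · obtain ⟨d, hd, hdmin⟩ := exists_min_image _ (fun x : Submodule K V => finrank K x) hne
      rw [mem_filter] at hd
      have hdr := hF d hd.1
      have hdy := Submodule.finrank_mono hd.2.le
      refine le_trans (card_le_card ?_) ((card_covers_top hq hd.2.le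
        (d := a + 1 - finrank K d) (by omega)).le.trans (qInt_mono q (by omega)))
      intro w hw
      simp only [mem_filter, mem_univ, true_and] at hw ⊢
      obtain ⟨hwy, hwa, x, hx, hxw⟩ := hw
      have hxy : x < y := lt_of_le_of_finrank_lt (hxw.trans hwy) (by
        have := Submodule.finrank_mono hxw
        omega)
      refine ⟨le_trans ?_ hxw, hwy, by omega⟩
      rcases hdown.comparable hy hd.1 hx hd.2 hxy with h | h
      · exact h
      · exact (Submodule.eq_of_le_of_finrank_le h (hdmin x (mem_filter.2 ⟨hx, hxy⟩))).ge
    · rw [card_eq_zero.2]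
      · exact Nat.zero_le _
      · rw [filter_eq_empty_iff]
        rintro w - ⟨hwy, hwa, x, hx, hxw⟩
        refine hne ⟨x, mem_filter.2 ⟨hx, lt_of_le_of_finrank_lt (hxw.trans hwy) ?_⟩⟩
        have := Submodule.finrank_mono hxw
        omega
  have hsub : ({w : Submodule K V | ⊥ ≤ w ∧ w ≤ y ∧ finrank K w + 1 = finrank K y} :
      Finset (Submodule K V)) ⊆
      ({w | finrank K w + 1 = a + 1 ∧ (∀ x ∈ F, ¬ x ≤ w) ∧ w ≤ y} : Finset (Submodule K V)) ∪
        ({w | w ≤ y ∧ finrank K w = a ∧ ∃ x ∈ F, x ≤ w} : Finset (Submodule K V)) := by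
    intro w hw
    simp only [mem_union, mem_filter, mem_univ, true_and] at hw ⊢
    by_cases h : ∃ x ∈ F, x ≤ w
    · exact Or.inr ⟨hw.2.1, by omega, h⟩
    · push Not at h
      exact Or.inl ⟨by omega, h, hw.2.1⟩
  have h1 := (card_le_card hsub).trans (card_union_le _ _)
  rw [Nat.add_sub_cancel]
  omega

/-- The top level of a family can be moved down by one as long as it is above the middle. -/
lemma exists_push_step (hq : Fintype.card K = q) (hV : finrank K V = n) (hup : UpFree 1 F)
    (hdown : DownFree 1 F) {a b : ℕ} (ha : 1 ≤ a) (hab : a < b) (hb : n + 2 ≤ 2 * b)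
    (hF : ∀ x ∈ F, a ≤ finrank K x ∧ finrank K x ≤ b) :
    ∃ F' : Finset (Submodule K V), UpFree 1 F' ∧ DownFree 1 F' ∧ #F ≤ #F' ∧
      ∀ x ∈ F', a ≤ finrank K x ∧ finrank K x ≤ b - 1 := by
  have hq2 : 2 ≤ q := hq ▸ Fintype.one_lt_card
  set T := F.filter fun x : Submodule K V => finrank K x = b with hT
  set R := F.filter fun x : Submodule K V => ¬ finrank K x = b with hR
  set N : Finset (Submodule K V) :=
    {w | finrank K w + 1 = b ∧ (∀ x ∈ F, ¬ x ≤ w) ∧ ∃ y ∈ T, w ≤ y} with hN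
  have hmemN : ∀ {w}, w ∈ N ↔ finrank K w + 1 = b ∧ (∀ x ∈ F, ¬ x ≤ w) ∧ ∃ y ∈ T, w ≤ y := by
    simp [hN]
  have hmemR : ∀ {x}, x ∈ R ↔ x ∈ F ∧ ¬ finrank K x = b := by simp [hR]
  have hRb : ∀ x ∈ R, finrank K x + 1 ≤ b := fun x hx => by
    have := (hF x (hmemR.1 hx).1).2
    have := (hmemR.1 hx).2
    omega
  have hRF : R ⊆ F := filter_subset _ _
  -- The new members `N`, which replace the top level `T`, are comparable to no other member, so
  -- they create no forbidden configuration.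
  have hNR : ∀ w ∈ N, ∀ x ∈ R ∪ N, ¬ w < x ∧ ¬ x < w := by
    intro w hw x hx
    have hw' := hmemN.1 hw
    have hlt := @Submodule.finrank_lt_finrank_of_lt K V _ _ _ w x _
    have hlt' := @Submodule.finrank_lt_finrank_of_lt K V _ _ _ x w _
    rcases mem_union.1 hx with hx | hx
    · have h1 := hRb x hx
      exact ⟨fun h => by have := hlt h; omega, fun h => hw'.2.1 x (hRF hx) h.le⟩
    · have h1 := (hmemN.1 hx).1
      exact ⟨fun h => by have := hlt h; omega, fun h => by have := hlt' h; omega⟩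
  have hcase : ∀ x ∈ R ∪ N, ∀ y ∈ R ∪ N, x < y → x ∈ R ∧ y ∈ R := by
    intro x hx y hy hxy
    constructor
    · exact (mem_union.1 hx).resolve_right fun h => (hNR x h y hy).1 hxy
    · exact (mem_union.1 hy).resolve_right fun h => (hNR y h x hx).2 hxy
  have hTN : #T ≤ #N := by
    -- Each `y ∈ T` covers at least `q ^ (b - 1)` elements of `N`, and each of those is covered by
    -- fewer than `q ^ (n - b + 1)` elements of `T`; `n + 2 ≤ 2 b` compares the exponents.
    have h1 : #T * q ^ (b - 1) ≤ #N * q ^ (b - 1) := by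
      refine card_mul_le_card_mul (fun y w : Submodule K V => w ≤ y) (fun y hy => ?_)
        fun w hw => ?_
      · have hy' := mem_filter.1 hy
        refine (pow_le_card_covered hq hdown (by omega) (fun x hx => ha.trans (hF x hx).1) hy'.1
          hy'.2).trans (card_le_card fun w hw => ?_)
        simp only [mem_filter, mem_univ, true_and] at hw
        exact mem_filter.2 ⟨hmemN.2 ⟨hw.1, hw.2.1, y, hy, hw.2.2⟩, hw.2.2⟩
      · have hw' := (hmemN.1 hw).1
        have hwn := Submodule.finrank_le w
        calc _ ≤ qInt q (n - (b - 1)) := by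
              rw [← card_covers_bot hq (u := w) (v := ⊤) le_top (d := n - (b - 1))
                (by rw [finrank_top]; omega)]
              refine card_le_card fun y hy => ?_
              simp only [bipartiteBelow, mem_filter, hT] at hy
              simp only [mem_filter, mem_univ, true_and]
              exact ⟨hy.2, le_top, by omega⟩
          _ ≤ q ^ (n - (b - 1)) := (qInt_lt_pow hq2 _).le
          _ ≤ q ^ (b - 1) := Nat.pow_le_pow_right (by omega) (by omega)
    exact Nat.le_of_mul_le_mul_right h1 (by positivity)
  refine ⟨R ∪ N, upFree_one_of_forall ?_, downFree_one_of_forall ?_, ?_, ?_⟩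
  · intro x hx y hy z hz hxy hxz
    obtain ⟨h1, h2⟩ := hcase x hx y hy hxy
    exact hup.comparable (hRF h1) (hRF h2) (hRF (hcase x hx z hz hxz).2) hxy hxz
  · intro x hx y hy z hz hxy hxz
    obtain ⟨h1, h2⟩ := hcase y hy x hx hxy
    exact hdown.comparable (hRF h2) (hRF h1) (hRF (hcase z hz x hx hxz).1) hxy hxz
  · have h1 : #T + #R = #F := card_filter_add_card_filter_not _
    rw [card_union_of_disjoint]
    · omega
    · rw [disjoint_left]
      exact fun x hx hx' => (hmemN.1 hx').2.1 x (hRF hx) le_rfl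
  · intro x hx
    rcases mem_union.1 hx with hx | hx
    · have h1 := hRb x hx
      exact ⟨(hF x (hRF hx)).1, by omega⟩
    · have h1 := (hmemN.1 hx).1
      omega

lemma exists_push (hq : Fintype.card K = q) (hV : finrank K V = n) {a : ℕ} (ha : 1 ≤ a)
    (han : a ≤ (n + 1) / 2) (hup : UpFree 1 F) (hdown : DownFree 1 F)
    (hF : ∀ x ∈ F, a ≤ finrank K x) :
    ∃ F' : Finset (Submodule K V), UpFree 1 F' ∧ DownFree 1 F' ∧ #F ≤ #F' ∧
      ∀ x ∈ F', a ≤ finrank K x ∧ finrank K x ≤ (n + 1) / 2 := by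
  have key : ∀ b : ℕ, ∀ F : Finset (Submodule K V), UpFree 1 F → DownFree 1 F →
      (∀ x ∈ F, a ≤ finrank K x ∧ finrank K x ≤ b) →
      ∃ F' : Finset (Submodule K V), UpFree 1 F' ∧ DownFree 1 F' ∧ #F ≤ #F' ∧
        ∀ x ∈ F', a ≤ finrank K x ∧ finrank K x ≤ (n + 1) / 2 := by
    intro b
    induction b with
    | zero =>
      intro F hup hdown hF
      exact ⟨F, hup, hdown, le_rfl, fun x hx => ⟨(hF x hx).1, (hF x hx).2.trans (by omega)⟩⟩
    | succ b ih =>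
      intro F hup hdown hF
      by_cases hb : b + 1 ≤ (n + 1) / 2
      · exact ⟨F, hup, hdown, le_rfl, fun x hx => ⟨(hF x hx).1, (hF x hx).2.trans hb⟩⟩
      · obtain ⟨F₁, hup₁, hdown₁, hle₁, hF₁⟩ :=
          exists_push_step hq hV hup hdown ha (by omega) (by omega) hF
        obtain ⟨F₂, hup₂, hdown₂, hle₂, hF₂⟩ := ih F₁ hup₁ hdown₁ hF₁
        exact ⟨F₂, hup₂, hdown₂, hle₁.trans hle₂, hF₂⟩
  exact key n F hup hdown fun x hx => ⟨hF x hx, hV ▸ Submodule.finrank_le x⟩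

end Push

/-! ### The upper bound for `k = 1`. -/

section UpperBoundOne

open scoped Classical

variable {K V : Type*} [Field K] [AddCommGroup V] [Module K V] [FiniteDimensional K V]
  [Fintype K] {q n : ℕ} {F : Finset (Submodule K V)}

lemma card_le_qSigma_of_middle (hq : Fintype.card K = q) (hV : finrank K V = n) (hn : 2 ≤ n)
    (hup : UpFree 1 F) (hdown : DownFree 1 F)
    (hF : ∀ x ∈ F, n / 2 ≤ finrank K x ∧ finrank K x ≤ (n + 1) / 2) :
    (#F : ℚ) ≤ qSigma q n 1 := by
  obtain ⟨h1, h2⟩ := finite_submodule_and_equiv K V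
  have := Fintype.ofFinite (Submodule K V)
  have := Fintype.ofFinite (V ≃ₗ[K] V)
  obtain ⟨c, hc0, -, hcF, -⟩ := exists_threshold (V := V) hq hV (k := 1) le_rfl hn
  have hlub : lubell F ≤ 1 := by
    obtain ⟨m, rfl | rfl⟩ := n.even_or_odd'
    · refine lubell_le_one_of_level hV (m := m) (by omega) fun x hx => ?_
      have := hF x hx
      omega
    · refine lubell_le_one_of_two_levels hq (by omega) hV hup hdown fun x hx => ?_
      have := hF x hx
      omega
  have h3 := hcF F
  push_cast at h3
  nlinarith

lemma card_le_qSigma_one (hq : Fintype.card K = q) (hV : finrank K V = n) (hn : 2 ≤ n)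
    (hup : UpFree 1 F) (hdown : DownFree 1 F) : (#F : ℚ) ≤ qSigma q n 1 := by
  obtain ⟨h1, h2⟩ := finite_submodule_and_equiv K V
  have := Fintype.ofFinite (Submodule K V)
  by_cases hbot : ⊥ ∈ F
  · obtain ⟨c, -, -, -, hc⟩ := exists_threshold (V := V) hq hV (k := 1) le_rfl hn
    obtain ⟨hc1, hc2⟩ := hc rfl
    have hcomp : ∀ x ∈ F, ∀ y ∈ F, x ≤ y ∨ y ≤ x := by
      intro x hx y hy
      rcases eq_bot_or_bot_lt x with rfl | hx0
      · exact Or.inl bot_le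
      rcases eq_bot_or_bot_lt y with rfl | hy0
      · exact Or.inr bot_le
      exact hup.comparable hbot hx hy hx0 hy0
    have h3 : #F ≤ #(range (n + 1)) := by
      refine card_le_card_of_injOn (fun x => finrank K x) (fun x _ => ?_) fun x hx y hy h =>
        eq_of_comparable_of_finrank_eq (hcomp x hx y hy) h
      have := Submodule.finrank_le x
      simp only [coe_range, Set.mem_Iio]
      omega
    rw [card_range] at h3
    rw [hc1]
    exact le_trans (by exact_mod_cast h3) hc2
  obtain ⟨h3, -⟩ := finite_submodule_and_equiv K (Dual K V)
  have := Fintype.ofFinite (Submodule K (Dual K V))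
  have hVd : finrank K (Dual K V) = n := Subspace.dual_finrank_eq.trans hV
  obtain ⟨F₁, hup₁, hdown₁, hle₁, hF₁⟩ := exists_push hq hV (a := 1) le_rfl (by omega) hup hdown
    fun x hx => by
      rw [Nat.one_le_iff_ne_zero, Ne, Submodule.finrank_eq_zero]
      rintro rfl
      exact hbot hx
  -- Annihilators of subspaces of dimension at most `(n + 1) / 2` have dimension at least `n / 2`,
  -- so a second push, in the dual space, confines the family to the middle.
  obtain ⟨F₂, hup₂, hdown₂, hle₂, hF₂⟩ := exists_push hq hVd (a := n / 2) (by omega) (by omega)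
    (hdown₁.image_anti dualAnnihilator_le_iff) (hup₁.image_anti dualAnnihilator_le_iff)
    fun x hx => by
      obtain ⟨y, hy, rfl⟩ := mem_image.1 hx
      have h4 := (hF₁ y hy).2
      have h5 := finrank_dualAnnihilator y
      omega
  have hle₃ : #F₁ ≤ #F₂ := (card_image_of_injective F₁ dualAnnihilator_injective).ge.trans hle₂
  refine le_trans ?_ (card_le_qSigma_of_middle hq hVd hn hup₂ hdown₂ hF₂)
  exact_mod_cast hle₁.trans hle₃

end UpperBoundOne

/-! ### From forbidden posets to comparability, and the extremal family. -/

section Embedding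

open scoped Classical

lemma exists_enumeration_of_chain {β : Type*} [PartialOrder β] {k : ℕ} {s : Finset β}
    (hc : IsChain (· ≤ ·) (s : Set β)) (hk : #s = k) :
    ∃ c : Fin k → β, (∀ i, c i ∈ s) ∧ ∀ i j, c i ≤ c j ↔ i ≤ j := by
  let _ : LinearOrder (s : Set β) := hc.linearOrder
  have e := Fintype.orderIsoFinOfCardEq (s : Set β) (k := k) (by simpa using hk)
  exact ⟨fun i => e i, fun i => (e i).2, fun i j => e.le_iff_le⟩

/-- Two incomparable elements above a `k`-element chain form an induced copy of `Y_k`. -/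
lemma exists_yPoset_embedding {β : Type*} [PartialOrder β] {k : ℕ} {s : Finset β}
    (hc : IsChain (· ≤ ·) (s : Set β)) (hk : #s = k) {y z : β} (hy : ∀ x ∈ s, x < y)
    (hz : ∀ x ∈ s, x < z) (hyz : ¬ (y ≤ z ∨ z ≤ y)) :
    ∃ f : YPoset k → β, (∀ a b, a ≤ b ↔ f a ≤ f b) ∧ ∀ a, f a ∈ s ∨ f a = y ∨ f a = z := by
  obtain ⟨c, hcs, hcle⟩ := exists_enumeration_of_chain hc hk
  push Not at hyz
  refine ⟨fun a => match a with
    | .x i => c i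
    | .y => y
    | .z => z, fun a b => ?_, fun a => ?_⟩
  · have hcy := fun i => hy _ (hcs i)
    have hcz := fun i => hz _ (hcs i)
    change YPoset.le a b ↔ _
    rcases a with i | _ | _ <;> rcases b with j | _ | _ <;> simp only [YPoset.le]
    · exact (hcle i j).symm
    · simpa using (hcy i).le
    · simpa using (hcz i).le
    · simpa using (hcy j).not_ge
    · simp
    · simpa using hyz.1
    · simpa using (hcz j).not_ge
    · simpa using hyz.2
    · simp
  · rcases a with i | _ | _
    · exact Or.inl (hcs i)
    · exact Or.inr (Or.inl rfl)
    · exact Or.inr (Or.inr rfl)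

variable {α : Type*} [PartialOrder α] {k : ℕ} {F : Finset α}

lemma upFree_of_not_isInducedSubposet (h : ¬ IsInducedSubposet (YPoset k) F) : UpFree k F := by
  intro s hs hc hk y hy z hz hsy hsz
  by_contra hyz
  obtain ⟨f, hf, hfF⟩ := exists_yPoset_embedding hc hk hsy hsz hyz
  have hmem : ∀ a, f a ∈ F := fun a => by
    rcases hfF a with h | h | h
    · exact hs h
    · rwa [h]
    · rwa [h]
  refine h ⟨fun a => ⟨f a, hmem a⟩, fun a b hab => ?_, fun a b => hf a b⟩
  have hab' : f a = f b := congrArg Subtype.val hab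
  exact le_antisymm ((hf _ _).2 hab'.le) ((hf _ _).2 hab'.ge)

lemma downFree_of_not_isInducedSubposet (h : ¬ IsInducedSubposet (YPoset k)ᵒᵈ F) :
    DownFree k F := by
  intro s hs hc hk y hy z hz hsy hsz
  by_contra hyz
  have hc' : IsChain (α := αᵒᵈ) (· ≤ ·) (s : Set α) := hc.symm
  obtain ⟨f, hf, hfF⟩ := exists_yPoset_embedding (β := αᵒᵈ) (s := s) hc' hk
    (y := OrderDual.toDual y) (z := OrderDual.toDual z) hsy hsz (fun h => hyz h.symm)
  have hmem : ∀ a, OrderDual.ofDual (f a) ∈ F := fun a => by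
    rcases hfF a with h | h | h
    · exact hs h
    · rwa [h]
    · rwa [h]
  refine h ⟨fun a => ⟨OrderDual.ofDual (f (OrderDual.ofDual a)), hmem _⟩, fun a b hab => ?_,
    fun a b => hf (OrderDual.ofDual b) (OrderDual.ofDual a)⟩
  have hab' : f (OrderDual.ofDual a) = f (OrderDual.ofDual b) := congrArg Subtype.val hab
  exact le_antisymm (α := YPoset k) ((hf _ _).2 hab'.le) ((hf _ _).2 hab'.ge)

lemma IsInducedSubposet.isSubposet {P Q : Type*} [PartialOrder P] [PartialOrder Q]
    (h : IsInducedSubposet P Q) : IsSubposet P Q := by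
  obtain ⟨φ, hφ, hle⟩ := h
  exact ⟨φ, hφ, fun a b hab => (hle a b).1 hab⟩

variable {K V : Type*} [Field K] [AddCommGroup V] [Module K V] [FiniteDimensional K V]

/-- A poset with more than `#S` pairwise comparable elements does not embed into the family of
subspaces with dimensions in `S`. -/
lemma not_isSubposet_of_finrank_mem {P ι : Type*} [PartialOrder P] [Fintype ι] {c : ι → P}
    (hc : Function.Injective c) (hcomp : ∀ i j, c i ≤ c j ∨ c j ≤ c i) {S : Finset ℕ}
    (hS : #S < Fintype.card ι) {F : Finset (Submodule K V)} (hF : ∀ x ∈ F, finrank K x ∈ S) :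
    ¬ IsSubposet P F := by
  rintro ⟨φ, hφ, hle⟩
  refine hS.not_ge ?_
  rw [← card_univ]
  refine card_le_card_of_injOn (fun i => finrank K (φ (c i) : Submodule K V))
    (fun i _ => hF _ (φ (c i)).2) fun i _ j _ hij => ?_
  apply hc
  apply hφ
  apply Subtype.ext
  exact eq_of_comparable_of_finrank_eq ((hcomp i j).imp (hle _ _) (hle _ _)) hij

/-- A maximal chain of `Y_k`. -/
def YPoset.chain (k : ℕ) : Option (Fin k) → YPoset k
  | none => .y
  | some i => .x i

lemma YPoset.chain_injective (k : ℕ) : Function.Injective (YPoset.chain k) := by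
  rintro (_ | i) (_ | j) h <;> simp_all [YPoset.chain]

lemma YPoset.chain_comparable (k : ℕ) (i j : Option (Fin k)) :
    YPoset.chain k i ≤ YPoset.chain k j ∨ YPoset.chain k j ≤ YPoset.chain k i := by
  change YPoset.le _ _ ∨ YPoset.le _ _
  rcases i with _ | i <;> rcases j with _ | j <;> simp [YPoset.chain, YPoset.le, le_total]

/-- Both posets contain a chain of `k + 1` elements, whose images would need `k + 1` distinct
dimensions. -/
lemma not_isSubposet_of_mem_yPair {S : Finset ℕ} (hS : #S = k) {F : Finset (Submodule K V)}
    (hF : ∀ x ∈ F, finrank K x ∈ S) : ∀ P ∈ yPair k, ¬ IsSubposet P F := by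
  intro P hP
  have hcard : #S < Fintype.card (Option (Fin k)) := by simp [hS]
  rcases hP with rfl | rfl
  · exact not_isSubposet_of_finrank_mem (YPoset.chain_injective k) (YPoset.chain_comparable k)
      hcard hF
  · exact not_isSubposet_of_finrank_mem (P := (YPoset k)ᵒᵈ)
      (c := fun i => OrderDual.toDual (YPoset.chain k i)) (YPoset.chain_injective k)
      (fun i j => (YPoset.chain_comparable k i j).symm) hcard hF

lemma nonempty_of_mem_yPair : ∀ P ∈ yPair k, Nonempty P := by
  rintro P (rfl | rfl)
  · exact ⟨YPoset.y⟩
  · exact ⟨OrderDual.toDual YPoset.y⟩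

lemma card_le_qSigma [Fintype K] {q n : ℕ} (hq : Fintype.card K = q) (hV : finrank K V = n)
    (hk : 1 ≤ k) (hn : k + 1 ≤ n) {F : Finset (Submodule K V)}
    (hF : ∀ P ∈ yPair k, ¬ IsInducedSubposet P F) : (#F : ℚ) ≤ qSigma q n k := by
  have hup : UpFree k F := upFree_of_not_isInducedSubposet (hF _ (Or.inl rfl))
  have hdown : DownFree k F := downFree_of_not_isInducedSubposet (hF _ (Or.inr rfl))
  rcases hk.eq_or_lt with rfl | hk
  · exact card_le_qSigma_one hq hV hn hup hdown
  · exact card_le_qSigma_of_two_le hq hV hk hn hup hdown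

lemma exists_card_eq_qSigma [Fintype K] {q n : ℕ} (hq : Fintype.card K = q)
    (hV : finrank K V = n) (hn : k + 1 ≤ n) :
    ∃ F : Finset (Submodule K V), (#F : ℚ) = qSigma q n k ∧
      ∀ P ∈ yPair k, ¬ IsSubposet P F := by
  obtain ⟨h1, -⟩ := finite_submodule_and_equiv K V
  have := Fintype.ofFinite (Submodule K V)
  obtain ⟨S, -, hSk, hsum, -⟩ := exists_top_levels (V := V) hq hV (k := k) (by omega)
  refine ⟨({x | finrank K x ∈ S} : Finset (Submodule K V)), ?_,
    not_isSubposet_of_mem_yPair hSk fun x hx => (mem_filter.1 hx).2⟩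
  have hmaps : ∀ x ∈ ({x | finrank K x ∈ S} : Finset (Submodule K V)), finrank K x ∈ S :=
    fun x hx => (mem_filter.1 hx).2
  rw [hsum, card_eq_sum_card_fiberwise hmaps, Nat.cast_sum]
  refine sum_congr rfl fun i hi => ?_
  rw [levelCard, filter_filter]
  congr 2
  ext x
  simp only [mem_filter, mem_univ, true_and, and_iff_right_iff_imp]
  rintro rfl
  exact hi

end Embedding

theorem mainTheorem6 {K V : Type*} [Field K] [Fintype K] [AddCommGroup V] [Module K V]
    [FiniteDimensional K V] (q n k : ℕ) (hq : Fintype.card K = q)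
    (hV : Module.finrank K V = n) (hk : 1 ≤ k) (hn : k + 1 ≤ n) :
    (LaStar K V (yPair k) : ℚ) = qSigma q n k ∧
      (La K V (yPair k) : ℚ) = qSigma q n k := by
  obtain ⟨F, hF, hfree⟩ := exists_card_eq_qSigma (V := V) hq hV hn
  have hind : ∀ P ∈ yPair k, ¬ IsInducedSubposet P F := fun P hP h => hfree P hP h.isSubposet
  obtain ⟨⟨F₁, hF₁, hfree₁⟩, hmax₁⟩ := isGreatest_LaStar K V (yPair k) nonempty_of_mem_yPair
  obtain ⟨⟨F₂, hF₂, hfree₂⟩, hmax₂⟩ := isGreatest_La K V (yPair k) nonempty_of_mem_yPair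
  refine ⟨le_antisymm ?_ ?_, le_antisymm ?_ ?_⟩
  · rw [← hF₁]
    exact card_le_qSigma hq hV hk hn hfree₁
  · rw [← hF]
    exact_mod_cast hmax₁ ⟨F, rfl, hind⟩
  · rw [← hF₂]
    exact card_le_qSigma hq hV hk hn fun P hP h => hfree₂ P hP h.isSubposet
  · rw [← hF]
    exact_mod_cast hmax₂ ⟨F, rfl, hfree⟩
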